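/- Let $d\in\mathbb N$ and let $W=C([0,1],\mathbb R^d)$ with the sup norm $|\cdot|_W$, its Borel $\sigma$-field $\mathcal B(W)$ and the evaluation process $(W_t)_{t\in[0,1]}$. For a Borel probability $\eta$ on $W$ and a $\sigma$-field $\mathcal G\subset\mathcal B(W)$, let $\mathcal G^\eta$ be the $\eta$-completion of $\mathcal G$, and let $\mathcal F^\eta_t$ be the $\eta$-completion of $\bigcap_{s>t}\sigma(W_r,\ r\le s)$ for $t<1$, and $\mathcal F_1^\eta=\mathcal B(W)^\eta$. Maps $W\to W$ that are $\mathcal B(W)^\eta/\mathcal B(W)$-measurable are identified when they are $\eta$-a.s. equal; such a class $U$ is called adapted (under $\eta$) if $U_t$ is $\mathcal F^\eta_t$-measurable for all $t\in[0,1]$. Let $\mathcal I^0_f(\eta)$ be the set of adapted classes $U$ for which $\sigma(W_0)^\eta=\sigma(U_0)^\eta$ and for which there is a class $\widetilde U$, adapted under $U_\star\eta$, with $\widetilde U\circ U=I_W$ $\eta$-a.s. and $U\circ\widetilde U=I_W$ $U_\star\eta$-a.s. (the isomorphisms of filtered probability spaces from $(W,\mathcal F^\eta_\cdot,\eta)$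 to $(W,\mathcal F^{U_\star\eta}_\cdot,U_\star\eta)$ that preserve the initial information). Let $H$ be the space of paths $h=\int_0^\cdot\dot h_s\,ds$ with $\dot h\in L^2([0,1],\mathbb R^d)$, with norm $|h|_H=\big(\int_0^1|\dot h_s|^2ds\big)^{1/2}$, and let $H_{0,0}=\{h\in H: h_1=0\}$. For a Borel probability $\nu$ on $W$ and $E\in\{H,H_{0,0}\}$, let $L^2_a(\nu,E)$ be the set of adapted classes $u$ (under $\nu$) with $u\in E$ $\nu$-a.s. and $\|u\|_{L^2(\nu,H)}^2:=E_\nu[|u|_H^2]<\infty$. Let $L^\infty(\nu,W)$ (resp. $L^\infty(\nu,H)$) be the set of classes $u$ such that, for some constant $K>0$, $|u|_W<K$ $\nu$-a.s. (resp. $u\in H$ and $|u|_H<K$ $\nu$-a.s.). Put $$V_\nu=\{h\in L^2_a(\nu,H):\ U+h\in\mathcal I^0_f(\nu)\ \text{for every}\ U\in\mathcal I^0_f(\nu)\},\qquad V_\nu^\infty=V_\nu\cap L^\infty(\nu,W),$$ $$V_\nu^0=V_\nu\cap L^2_a(\nu,H_{0,0}),\qquad V_\nu^{0,\infty}=V_\nu^\infty\cap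 V_\nu^0 .$$ Then, for every Borel probability $\nu$ on $W$, in the norm of $L^2(\nu,H)$: 1. $V_\nu^\infty\cap L^\infty(\nu,H)$ is dense in $L^2_a(\nu,H)$, and hence so are $V_\nu^\infty$ and $V_\nu$; 2. $V_\nu^{0,\infty}$ is dense in $L^2_a(\nu,H_{0,0})$. -/

import Mathlib

open MeasureTheory
open scoped unitInterval ENNReal

noncomputable section

namespace VariationProcess

/-- The path space `W = C([0,1], ℝ^d)`, with its supremum norm. -/
abbrev PathSpace (d : ℕ) : Type := C(I, EuclideanSpace ℝ (Fin d))

/-- The Borel σ-field `B(W)`. -/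
instance instMeasurableSpacePathSpace (d : ℕ) : MeasurableSpace (PathSpace d) :=
  borel (PathSpace d)

instance instBorelSpacePathSpace (d : ℕ) : BorelSpace (PathSpace d) := ⟨rfl⟩

variable {d : ℕ}

/-! ### The Cameron-Martin space -/

/-- `g` is a square integrable derivative of `h`: `g ∈ L²([0,1], ℝ^d)` and
`h_t = ∫_0^t g_s ds` for all `t ∈ [0,1]`. -/
def IsL2Deriv (h : PathSpace d) (g : ℝ → EuclideanSpace ℝ (Fin d)) : Prop :=
  MemLp g 2 (volume.restrict (Set.Icc (0 : ℝ) 1)) ∧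
    ∀ t : I, h t = ∫ s in (0 : ℝ)..(t : ℝ), g s

/-- The Cameron-Martin space `H`, as a set of paths. -/
def cameronMartin (d : ℕ) : Set (PathSpace d) :=
  {h | ∃ g : ℝ → EuclideanSpace ℝ (Fin d), IsL2Deriv h g}

/-- The paths `h ∈ H` with `h_1 = 0`. -/
def cameronMartinZero (d : ℕ) : Set (PathSpace d) :=
  {h | h ∈ cameronMartin d ∧ h 1 = 0}

/-- The norm `|h|_H = (∫_0^1 |ḣ_s|² ds)^{1/2}` for `h ∈ H`, and `∞` for `h ∉ H`. (For `h ∈ H` the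
derivative is unique up to a Lebesgue null set, so that the infimum is over a single value.) -/
def cmNorm (h : PathSpace d) : ℝ≥0∞ :=
  ⨅ (g : ℝ → EuclideanSpace ℝ (Fin d)) (_ : IsL2Deriv h g),
    eLpNorm g 2 (volume.restrict (Set.Icc (0 : ℝ) 1))

/-! ### The augmented filtration of the evaluation process -/

/-- `B_t^0(W) = σ(W_s, s ≤ t)`. -/
@[reducible] def evalSigma (d : ℕ) (t : I) : MeasurableSpace (PathSpace d) :=
  ⨆ (s : I) (_ : s ≤ t),
    MeasurableSpace.comap (fun ω : PathSpace d => ω s)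
      (inferInstance : MeasurableSpace (EuclideanSpace ℝ (Fin d)))

open Classical in
/-- `B_{t+}^0(W) = ⋂_{s > t} B_s^0(W)` for `t < 1`, and `B_{1+}^0(W) = B(W)`. -/
@[reducible] def evalSigmaRight (d : ℕ) (t : I) : MeasurableSpace (PathSpace d) :=
  if t = 1 then borel (PathSpace d) else ⨅ (s : I) (_ : t < s), evalSigma d s

/-- The `η`-completion `𝒢^η`: the sets that differ from a set of `𝒢` by an `η`-negligible set. -/
abbrev completion (η : Measure (PathSpace d)) (𝒢 : MeasurableSpace (PathSpace d)) :
    MeasurableSpace (PathSpace d) :=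
  eventuallyMeasurableSpace 𝒢 (ae η)

/-- The usual augmentation `F_t^η` of the filtration of the evaluation process, namely the
`η`-completion of `B_{t+}^0(W)`. -/
@[reducible] def augFiltration (η : Measure (PathSpace d)) (t : I) : MeasurableSpace (PathSpace d) :=
  completion η (evalSigmaRight d t)

/-! ### Morphisms of probability spaces and their adaptedness

An `η`-equivalence class of `B(W)^η / B(W)`-measurable maps `W → W` is an element of `W →ₘ[η] W`. -/

/-- `U` is `(F_t^η)`-adapted. The σ-fields `F_t^η` contain the `η`-negligible sets, so that this
does not depend on the representative of `U`. -/
def IsAdapted (η : Measure (PathSpace d)) (U : PathSpace d →ₘ[η] PathSpace d) : Prop :=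
  ∀ t : I, Measurable[augFiltration η t] (fun ω : PathSpace d => U ω t)

/-- `U` is an isomorphism of filtered probability spaces on `(W, F^η, η)` to
`(W, F^{U_⋆η}, U_⋆η)`: it is adapted, and it has an adapted almost sure inverse. -/
def IsFilteredIso (η : Measure (PathSpace d)) (U : PathSpace d →ₘ[η] PathSpace d) : Prop :=
  IsAdapted η U ∧
    ∃ V : PathSpace d →ₘ[η.map U] PathSpace d,
      IsAdapted (η.map U) V ∧ (∀ᵐ ω ∂η, V (U ω) = ω) ∧ ∀ᵐ ω ∂(η.map U), U (V ω) = ω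

/-- `I_f^0(η)`: the isomorphisms `U` of filtered probability spaces that preserve the initial
information, `σ(W_0)^η = σ(U_0)^η`. -/
def isoInitial (η : Measure (PathSpace d)) : Set (PathSpace d →ₘ[η] PathSpace d) :=
  {U | IsFilteredIso η U ∧
    completion η (MeasurableSpace.comap (fun ω : PathSpace d => ω 0)
        (inferInstance : MeasurableSpace (EuclideanSpace ℝ (Fin d)))) =
      completion η (MeasurableSpace.comap (fun ω : PathSpace d => U ω 0)
        (inferInstance : MeasurableSpace (EuclideanSpace ℝ (Fin d))))}

/-! ### The spaces of shifts -/

/-- The norm `(E_ν[|u|_H²])^{1/2}`; it is `∞` if `u ∉ H` with positive probability. -/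
def l2Norm (ν : Measure (PathSpace d)) (u : PathSpace d →ₘ[ν] PathSpace d) : ℝ≥0∞ :=
  (∫⁻ ω, cmNorm (u ω) ^ 2 ∂ν) ^ (1 / 2 : ℝ)

/-- `L²_a(ν, E)` for `E ⊆ H`: the adapted `u` with `u ∈ E` almost surely and `E_ν[|u|_H²] < ∞`. -/
def l2Adapted (ν : Measure (PathSpace d)) (E : Set (PathSpace d)) :
    Set (PathSpace d →ₘ[ν] PathSpace d) :=
  {u | (∀ᵐ ω ∂ν, u ω ∈ E) ∧ l2Norm ν u < ∞ ∧ IsAdapted ν u}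

/-- `L^∞(ν, W)`. -/
def lInftyW (ν : Measure (PathSpace d)) : Set (PathSpace d →ₘ[ν] PathSpace d) :=
  {u | ∃ K : ℝ, 0 < K ∧ ∀ᵐ ω ∂ν, ‖u ω‖ < K}

/-- `L^∞(ν, H)`. -/
def lInftyH (ν : Measure (PathSpace d)) : Set (PathSpace d →ₘ[ν] PathSpace d) :=
  {u | (∀ᵐ ω ∂ν, u ω ∈ cameronMartin d) ∧
    ∃ K : ℝ, 0 < K ∧ ∀ᵐ ω ∂ν, cmNorm (u ω) < ENNReal.ofReal K}

/-- `V_ν`: the variation processes of `ν`. -/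
def variation (ν : Measure (PathSpace d)) : Set (PathSpace d →ₘ[ν] PathSpace d) :=
  {h | h ∈ l2Adapted ν (cameronMartin d) ∧ ∀ U ∈ isoInitial ν, U + h ∈ isoInitial ν}

/-- `V_ν^∞ = V_ν ∩ L^∞(ν, W)`. -/
def variationBdd (ν : Measure (PathSpace d)) : Set (PathSpace d →ₘ[ν] PathSpace d) :=
  variation ν ∩ lInftyW ν

/-- `V_ν^0`: the variation processes that vanish at both endpoints almost surely. -/
def variationZero (ν : Measure (PathSpace d)) : Set (PathSpace d →ₘ[ν] PathSpace d) :=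
  variation ν ∩ l2Adapted ν (cameronMartinZero d)

/-- `V_ν^{0,∞} = V_ν^∞ ∩ V_ν^0`. -/
def variationZeroBdd (ν : Measure (PathSpace d)) : Set (PathSpace d →ₘ[ν] PathSpace d) :=
  variationBdd ν ∩ variationZero ν

/-- `A` is a dense subset of `S` for the norm of `L²(ν, H)`. -/
def IsL2Dense (ν : Measure (PathSpace d)) (A S : Set (PathSpace d →ₘ[ν] PathSpace d)) : Prop :=
  A ⊆ S ∧ ∀ u ∈ S, ∀ ε : ℝ, 0 < ε → ∃ v ∈ A, l2Norm ν (u - v) < ENNReal.ofReal ε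

end VariationProcess

end

noncomputable section
namespace VariationProcess
variable {d : ℕ}

open Filter Set Topology

/-! Two facts carry the proof. First, a shift `h` that is known a time `δ > 0` in advance, and
vanishes wherever that is impossible, preserves the initial-information isomorphisms
(`IsDelayed.add_mem_isoInitial`). Let `X = U + h`. Near time `0` the shift vanishes and `U = X`.
Once `U` is recovered from `X` up to some time, the isomorphism `U` gives back the original
filtration before that time, hence `h` slightly less than `δ` later, hence `U = X - h` there.
Finitely many such steps exhaust `[0,1]`. So `X` generates the original filtration, and an adapted
inverse comes from factoring the identity through `X` (`isFilteredIso_of_evalSigmaRight_le`).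

Second, delayed bounded processes are dense. Replace `u` by the piecewise linear path whose
increment on the `i`-th interval of mesh `1/N` is the increment of the clamped `u` two intervals
earlier (`isDelayed_delayedApprox`). On derivatives, the unclamped operation has norm at most `2` on
`L²` uniformly in `N`, and it converges on bounded continuous functions by local averaging, hence
strongly (`tendsto_eLpNorm_interpDeriv_sub`). The clamp bounds the approximation, does not increase
increments, and is inactive for large `N`. Dominated convergence over `ν` finishes
(`tendsto_l2Norm_sub_delayedApprox`).

If `u_1 = 0`, the last grid node is moved to time `1`. The increments then telescope to `0`, and
adaptedness survives because the value at time `1` is deterministic. -/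

/-! ### Completions of σ-fields -/

/-- A function that is measurable modulo a σ-filter agrees eventually with a measurable function. -/
theorem exists_measurable_eventuallyEq {Ω β : Type*} {m : MeasurableSpace Ω} {l : Filter Ω}
    [CountableInterFilter l] [MeasurableSpace β] [StandardBorelSpace β] [Nonempty β] {f : Ω → β}
    (hf : Measurable[eventuallyMeasurableSpace m l] f) :
    ∃ g : Ω → β, Measurable[m] g ∧ f =ᶠ[l] g := by
  classical
  have he : MeasurableEmbedding (MeasurableSpace.mapNatBool β) :=
    (MeasurableSpace.measurable_mapNatBool β).measurableEmbedding
      (MeasurableSpace.injective_mapNatBool β)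
  have h1 : ∀ n : ℕ, ∃ T : Set Ω, MeasurableSet[m] T ∧
      (f ⁻¹' MeasurableSpace.natGeneratingSequence β n) =ᶠ[l] T := fun n =>
    hf (MeasurableSpace.measurableSet_natGeneratingSequence n)
  choose T hT hfT using h1
  -- A left inverse of the binary coding, defined on all of `ℕ → Bool`: the modified code `c` may
  -- leave the range of the coding on the exceptional set.
  obtain ⟨r, hr, hre⟩ := he.exists_measurable_extend measurable_id fun _ => inferInstance
  let c : Ω → ℕ → Bool := fun ω n => decide (ω ∈ T n)
  have hc : Measurable[m] c := by
    refine @measurable_pi_lambda _ _ _ m _ _ fun n => ?_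
    exact @measurable_to_bool _ m _ (by
      have : (fun ω => c ω n) ⁻¹' {true} = T n := by ext ω; simp [c]
      exact this ▸ hT n)
  refine ⟨r ∘ c, hr.comp hc, ?_⟩
  have h2 : ∀ᶠ ω in l, ∀ n, (f ω ∈ MeasurableSpace.natGeneratingSequence β n) = (ω ∈ T n) :=
    eventually_countable_forall.2 fun n => hfT n
  filter_upwards [h2] with ω hω
  have h3 : c ω = MeasurableSpace.mapNatBool β (f ω) := by
    funext n
    simp [c, MeasurableSpace.mapNatBool, hω n]
  have h4 := congrFun hre (f ω)
  simp only [Function.comp_apply, id] at h4 ⊢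
  rw [h3, h4]

theorem eventuallyMeasurableSpace_mono {Ω : Type*} {m m' : MeasurableSpace Ω} {l : Filter Ω}
    [CountableInterFilter l] (h : m ≤ m') :
    eventuallyMeasurableSpace m l ≤ eventuallyMeasurableSpace m' l :=
  fun _ ⟨t, ht, hst⟩ => ⟨t, h t ht, hst⟩

theorem eventuallyMeasurableSpace_le_iff {Ω : Type*} {m m' : MeasurableSpace Ω} {l : Filter Ω}
    [CountableInterFilter l] :
    eventuallyMeasurableSpace m l ≤ eventuallyMeasurableSpace m' l ↔
      m ≤ eventuallyMeasurableSpace m' l := by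
  refine ⟨le_eventuallyMeasurableSpace.trans, fun h s ⟨t, ht, hst⟩ => ?_⟩
  obtain ⟨u, hu, htu⟩ := h t ht
  exact ⟨u, hu, hst.trans htu⟩

theorem comap_le_eventuallyMeasurableSpace_of_eventuallyEq {Ω β : Type*} {m : MeasurableSpace β}
    {l : Filter Ω} [CountableInterFilter l] {f g : Ω → β} (h : f =ᶠ[l] g) :
    m.comap f ≤ eventuallyMeasurableSpace (m.comap g) l := by
  rintro _ ⟨t, ht, rfl⟩
  exact ⟨g ⁻¹' t, ⟨t, ht, rfl⟩, h.preimage t⟩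

theorem eventuallyMeasurableSpace_comap_congr {Ω β : Type*} {m : MeasurableSpace β}
    {l : Filter Ω} [CountableInterFilter l] {f g : Ω → β} (h : f =ᶠ[l] g) :
    eventuallyMeasurableSpace (m.comap f) l = eventuallyMeasurableSpace (m.comap g) l :=
  le_antisymm
    (eventuallyMeasurableSpace_le_iff.2 (comap_le_eventuallyMeasurableSpace_of_eventuallyEq h))
    (eventuallyMeasurableSpace_le_iff.2 (comap_le_eventuallyMeasurableSpace_of_eventuallyEq h.symm))

theorem measurable_of_eventuallyEq {Ω β : Type*} [MeasurableSpace β] {m : MeasurableSpace Ω}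
    {l : Filter Ω} [CountableInterFilter l] {f g : Ω → β}
    (hf : Measurable[eventuallyMeasurableSpace m l] f) (h : g =ᶠ[l] f) :
    Measurable[eventuallyMeasurableSpace m l] g :=
  EventuallyMeasurable.congr hf h

/-! ### The filtration of the evaluation process -/

theorem evalSigma_mono {s t : I} (h : s ≤ t) : evalSigma d s ≤ evalSigma d t :=
  iSup₂_le fun r hr => le_iSup₂_of_le r (hr.trans h) le_rfl

theorem measurable_eval_evalSigma {s t : I} (h : s ≤ t) :
    Measurable[evalSigma d t] (fun ω : PathSpace d => ω s) := by
  rw [measurable_iff_comap_le]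
  exact le_iSup₂_of_le (f := fun (s : I) (_ : s ≤ t) =>
    MeasurableSpace.comap (fun ω : PathSpace d => ω s) inferInstance) s h le_rfl

theorem evalSigma_le_borel (t : I) : evalSigma d t ≤ borel (PathSpace d) :=
  iSup₂_le fun s _ =>
    have h : Measurable fun ω : PathSpace d => ω s := (continuous_eval_const s).measurable
    measurable_iff_comap_le.1 h

/-- Evaluations at a countable dense set of times separate paths. By Lusin–Souslin this continuous
injection between Polish spaces is a measurable embedding, so every Borel set is a preimage under
it. -/
theorem borel_le_evalSigma_one : borel (PathSpace d) ≤ evalSigma d 1 := by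
  let q := TopologicalSpace.denseSeq I
  let F : PathSpace d → ℕ → EuclideanSpace ℝ (Fin d) := fun ω n => ω (q n)
  have hF : Continuous F := continuous_pi fun n => continuous_eval_const (q n)
  have hinj : Function.Injective F := by
    intro ω ω' h
    have : (ω : I → EuclideanSpace ℝ (Fin d)) = ω' :=
      (TopologicalSpace.denseRange_denseSeq I).equalizer ω.continuous ω'.continuous
        (funext fun n => congrFun h n)
    exact DFunLike.coe_injective this
  have he := hF.measurable.measurableEmbedding hinj
  have hFm : Measurable[evalSigma d 1] F :=
    @measurable_pi_lambda _ _ _ (evalSigma d 1) _ _ fun n =>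
      measurable_eval_evalSigma unitInterval.le_one'
  intro A hA
  have hA' : F ⁻¹' (F '' A) = A := preimage_image_eq A hinj
  rw [← hA']
  exact hFm (he.measurableSet_image.2 hA)

theorem evalSigmaRight_one : evalSigmaRight d 1 = borel (PathSpace d) := if_pos rfl

theorem evalSigmaRight_of_ne {t : I} (ht : t ≠ 1) :
    evalSigmaRight d t = ⨅ (s : I) (_ : t < s), evalSigma d s := if_neg ht

theorem evalSigma_le_evalSigmaRight (t : I) : evalSigma d t ≤ evalSigmaRight d t := by
  by_cases ht : t = 1
  · rw [ht, evalSigmaRight_one]; exact evalSigma_le_borel 1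
  · rw [evalSigmaRight_of_ne ht]; exact le_iInf₂ fun s hs => evalSigma_mono hs.le

theorem evalSigmaRight_le_evalSigma {s t : I} (h : s < t) :
    evalSigmaRight d s ≤ evalSigma d t := by
  rw [evalSigmaRight_of_ne (h.trans_le unitInterval.le_one').ne]
  exact iInf₂_le t h

theorem evalSigmaRight_le_borel (t : I) : evalSigmaRight d t ≤ borel (PathSpace d) := by
  by_cases ht : t = 1
  · rw [ht, evalSigmaRight_one]
  · exact (evalSigmaRight_le_evalSigma (lt_of_le_of_ne unitInterval.le_one' ht)).trans
      (evalSigma_le_borel 1)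

theorem evalSigmaRight_mono {s t : I} (h : s ≤ t) : evalSigmaRight d s ≤ evalSigmaRight d t := by
  rcases h.eq_or_lt with rfl | h
  · exact le_rfl
  · exact (evalSigmaRight_le_evalSigma h).trans (evalSigma_le_evalSigmaRight t)

theorem augFiltration_mono (ν : Measure (PathSpace d)) {s t : I} (h : s ≤ t) :
    augFiltration ν s ≤ augFiltration ν t :=
  eventuallyMeasurableSpace_mono (evalSigmaRight_mono h)

/-- Right continuity: a set that belongs to the completion of `X⁻¹(B_s^0)` for all `s > t` belongs
to the completion of `X⁻¹(B_{t+}^0)`. -/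
theorem measurableSet_comap_evalSigmaRight {ν : Measure (PathSpace d)}
    {X : PathSpace d → PathSpace d} {t : I} (ht : t ≠ 1) {A : Set (PathSpace d)}
    (hA : ∀ s : I, t < s → MeasurableSet[completion ν ((evalSigma d s).comap X)] A) :
    MeasurableSet[completion ν ((evalSigmaRight d t).comap X)] A := by
  have ht1 : t < 1 := lt_of_le_of_ne unitInterval.le_one' ht
  obtain ⟨s, hs, hst, hlim⟩ := exists_seq_strictAnti_tendsto' ht1
  have h1 : ∀ n, ∃ B : Set (PathSpace d), MeasurableSet[evalSigma d (s n)] B ∧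
      A =ᵐ[ν] X ⁻¹' B := by
    intro n
    obtain ⟨_, ⟨B, hB, rfl⟩, h⟩ := hA (s n) (hst n).1
    exact ⟨B, hB, h⟩
  choose B hB hAB using h1
  -- The lower limit of the `B k` depends only on their tail, so it lies in the σ-field at each time
  -- `r > t`.
  refine ⟨X ⁻¹' {ω | ∃ n, ∀ k, n ≤ k → ω ∈ B k}, ⟨_, ?_, rfl⟩, ?_⟩
  · rw [evalSigmaRight_of_ne ht]
    simp only [MeasurableSpace.measurableSet_iInf]
    intro r hr
    obtain ⟨N, hN⟩ := (hlim.eventually_lt_const hr).exists_forall_of_atTop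
    have hset : {ω : PathSpace d | ∃ n, ∀ k, n ≤ k → ω ∈ B k} =
        ⋃ n, ⋂ k, ⋂ (_ : max n N ≤ k), B k := by
      ext ω
      simp only [mem_ofPred_eq, mem_iUnion, mem_iInter]
      exact ⟨fun ⟨n, h⟩ => ⟨n, fun k hk => h k ((le_max_left _ _).trans hk)⟩,
        fun ⟨n, h⟩ => ⟨max n N, h⟩⟩
    rw [hset]
    refine .iUnion fun n => .iInter fun k => .iInter fun hk =>
      evalSigma_mono (hN k ((le_max_right _ _).trans hk)).le _ (hB k)
  · have h2 : ∀ᵐ ω ∂ν, ∀ n, (ω ∈ A) = (X ω ∈ B n) := ae_all_iff.2 fun n => hAB n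
    filter_upwards [h2] with ω hω
    refine propext ⟨fun h => ⟨0, fun k _ => (hω k).mp h⟩, fun ⟨n, h⟩ => (hω n).mpr (h n le_rfl)⟩

/-- A process all of whose coordinates up to time `t` are measurable is measurable as a path. -/
theorem comap_evalSigma_le {m : MeasurableSpace (PathSpace d)} {X : PathSpace d → PathSpace d}
    {t : I} (h : ∀ s ≤ t, Measurable[m] (fun ω => X ω s)) : (evalSigma d t).comap X ≤ m := by
  simp only [evalSigma, MeasurableSpace.comap_iSup, MeasurableSpace.comap_comp]
  exact iSup₂_le fun s hs => measurable_iff_comap_le.1 (h s hs)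

/-- Passes from single times to the whole right-continuous filtration. For `t < 1`, a time strictly
between `t` and `s` absorbs the infinitesimal look-ahead on both sides; right continuity then lets
`s` decrease to `t`. -/
theorem comap_evalSigmaRight_le
    {ν : Measure (PathSpace d)} {X Y : PathSpace d → PathSpace d}
    (h : ∀ t, Measurable[completion ν ((evalSigmaRight d t).comap Y)] (fun ω => X ω t)) (t : I) :
    (evalSigmaRight d t).comap X ≤ completion ν ((evalSigmaRight d t).comap Y) := by
  have h0 : ∀ s : I, (evalSigma d s).comap X ≤ completion ν ((evalSigmaRight d s).comap Y) :=
    fun s => comap_evalSigma_le fun r hr => (h r).mono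
      (eventuallyMeasurableSpace_mono (MeasurableSpace.comap_mono (evalSigmaRight_mono hr))) le_rfl
  by_cases ht : t = 1
  · subst ht
    refine le_trans (MeasurableSpace.comap_mono ?_) (h0 1)
    rw [evalSigmaRight_one]
    exact borel_le_evalSigma_one
  intro A hA
  refine measurableSet_comap_evalSigmaRight ht fun s hs => ?_
  obtain ⟨r, htr, hrs⟩ := exists_between hs
  refine eventuallyMeasurableSpace_mono
    (MeasurableSpace.comap_mono (evalSigmaRight_le_evalSigma hrs)) _ (h0 r _ ?_)
  exact MeasurableSpace.comap_mono (evalSigmaRight_le_evalSigma htr) _ hA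

/-! ### Isomorphisms of filtered probability spaces -/

theorem IsAdapted.measurable_comap_evalSigmaRight_le {ν : Measure (PathSpace d)}
    {U : PathSpace d →ₘ[ν] PathSpace d} (hU : IsAdapted ν U) (t : I) :
    (evalSigmaRight d t).comap U ≤ augFiltration ν t := by
  have h := comap_evalSigmaRight_le (ν := ν) (X := U) (Y := id)
    (fun t => by rw [MeasurableSpace.comap_id]; exact hU t) t
  rwa [MeasurableSpace.comap_id] at h

/-- The filtration of the evaluation process is contained in the one generated by an isomorphism. -/
theorem IsFilteredIso.evalSigmaRight_le {ν : Measure (PathSpace d)}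
    {U : PathSpace d →ₘ[ν] PathSpace d} (hU : IsFilteredIso ν U) (t : I) :
    evalSigmaRight d t ≤ completion ν ((evalSigmaRight d t).comap U) := by
  obtain ⟨-, V, hV, hVU, -⟩ := hU
  intro A hA
  -- Adaptedness of the inverse replaces `V⁻¹ A` by a set `D` of the filtration; pulling back along
  -- `U` turns `V⁻¹ A` into `A`.
  obtain ⟨D, hD, hAD⟩ := hV.measurable_comap_evalSigmaRight_le t _ ⟨A, hA, rfl⟩
  refine ⟨U ⁻¹' D, ⟨D, hD, rfl⟩, ?_⟩
  filter_upwards [ae_of_ae_map U.aemeasurable hAD, hVU] with ω h1 h2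
  have h3 : (V (U ω) ∈ A) = (U ω ∈ D) := h1
  rw [h2] at h3
  exact h3

/-- An adapted map whose filtration contains the filtration of the evaluation process is an
isomorphism of filtered probability spaces. -/
theorem isFilteredIso_of_evalSigmaRight_le {ν : Measure (PathSpace d)}
    {X : PathSpace d →ₘ[ν] PathSpace d} (hX : IsAdapted ν X)
    (h : ∀ t, evalSigmaRight d t ≤ completion ν ((evalSigmaRight d t).comap X)) :
    IsFilteredIso ν X := by
  -- At `t = 1` the hypothesis says that the identity is measurable for the completed σ-field of
  -- `X`; its Doob–Dynkin factor `V` is the inverse.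
  have h1 : Measurable[completion ν ((borel (PathSpace d)).comap X)] (id : PathSpace d → _) := by
    have := h 1
    rw [evalSigmaRight_one] at this
    exact fun A hA => this A hA
  obtain ⟨g, hg, hgX⟩ := exists_measurable_eventuallyEq h1
  obtain ⟨V, hV, rfl⟩ := hg.exists_eq_measurable_comp
  let V' : PathSpace d →ₘ[ν.map X] PathSpace d := AEEqFun.mk V hV.aestronglyMeasurable
  have hV' : V' =ᵐ[ν.map X] V := AEEqFun.coeFn_mk _ _
  have hVX : ∀ᵐ ω ∂ν, V (X ω) = ω := hgX.mono fun ω hω => hω.symm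
  refine ⟨hX, V', fun t => ?_, ?_, ?_⟩
  · have hVt : Measurable[augFiltration (ν.map X) t] fun ω => V ω t := by
      intro B hB
      have heval : Measurable fun ω : PathSpace d => ω t := (continuous_eval_const t).measurable
      obtain ⟨_, ⟨D, hD, rfl⟩, hAD⟩ := eventuallyMeasurableSpace_le_iff.2 (h t) _ <|
        eventuallyMeasurableSpace_mono (evalSigma_le_evalSigmaRight t) _ <|
          le_eventuallyMeasurableSpace _ (measurable_eval_evalSigma (le_refl t) hB)
      refine ⟨D, hD, ?_⟩
      have hDm : MeasurableSet D := evalSigmaRight_le_borel t _ hD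
      have hBm : MeasurableSet ((fun ω => V ω t) ⁻¹' B) := (heval.comp hV) hB
      have hset : MeasurableSet {ω | (ω ∈ (fun ω => V ω t) ⁻¹' B) ↔ ω ∈ D} :=
        hBm.iff hDm
      have h2 : ∀ᵐ ω ∂(ν.map X), (ω ∈ (fun ω => V ω t) ⁻¹' B) ↔ ω ∈ D := by
        refine (ae_map_iff X.aemeasurable hset).2 ?_
        filter_upwards [hVX, hAD] with ω h3 h4
        have h5 : (ω t ∈ B) = (X ω ∈ D) := h4
        rw [mem_preimage, h3, h5]
      exact h2.mono fun ω hω => propext hω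
    exact measurable_of_eventuallyEq hVt (hV'.mono fun ω hω => by simp only [hω])
  · filter_upwards [ae_of_ae_map X.aemeasurable hV', hVX] with ω h1 h2
    rw [h1, h2]
  · have hXm : Measurable X := X.measurable
    have h1 : ∀ᵐ ω ∂(ν.map X), X (V ω) = ω :=
      (ae_map_iff X.aemeasurable (measurableSet_eq_fun (hXm.comp hV) measurable_id)).2 <|
        hVX.mono fun ω hω => congrArg X hω
    filter_upwards [hV', h1] with ω h2 h3
    rw [h2, h3]

/-- `h` vanishes initially and is known a time `δ` in advance. -/
def IsDelayed (ν : Measure (PathSpace d)) (δ : ℝ) (h : PathSpace d →ₘ[ν] PathSpace d) : Prop :=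
  ∀ t : I, (∀ᵐ ω ∂ν, h ω t = 0) ∨
    ∃ s : I, (s : ℝ) + δ ≤ t ∧ Measurable[augFiltration ν s] fun ω => h ω t

theorem IsDelayed.isAdapted {ν : Measure (PathSpace d)} {δ : ℝ} (hδ : 0 < δ)
    {h : PathSpace d →ₘ[ν] PathSpace d} (hh : IsDelayed ν δ h) : IsAdapted ν h := by
  intro t
  rcases hh t with h0 | ⟨s, hst, hs⟩
  · exact measurable_of_eventuallyEq (f := fun _ => 0) measurable_const h0
  · exact hs.mono (augFiltration_mono ν (Subtype.coe_le_coe.1 (by linarith))) le_rfl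

theorem IsAdapted.add {ν : Measure (PathSpace d)} {U h : PathSpace d →ₘ[ν] PathSpace d}
    (hU : IsAdapted ν U) (hh : IsAdapted ν h) : IsAdapted ν (U + h) := by
  intro t
  refine measurable_of_eventuallyEq (Measurable.add (m := augFiltration ν t) (hU t) (hh t)) ?_
  filter_upwards [AEEqFun.coeFn_add U h] with ω hω
  simp [hω]

/-- Shifts by delayed processes map `I_f^0(ν)` to itself: the original process is recovered from the
shifted one step by step in time. -/
theorem IsDelayed.add_mem_isoInitial {ν : Measure (PathSpace d)} {δ : ℝ} (hδ : 0 < δ)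
    {h U : PathSpace d →ₘ[ν] PathSpace d} (hh : IsDelayed ν δ h) (hU : U ∈ isoInitial ν) :
    U + h ∈ isoInitial ν := by
  obtain ⟨hU, hU0⟩ := hU
  set X := U + h with hX
  have hXU : ∀ᵐ ω ∂ν, X ω = U ω + h ω := AEEqFun.coeFn_add U h
  -- Time advances by `δ / 2` rather than `δ`: the σ-field at `s` looks infinitesimally beyond `s`,
  -- so `U` must already be known on an interval reaching strictly past `s`.
  have key : ∀ m : ℕ, ∀ t : I, (t : ℝ) ≤ m * (δ / 2) →
      Measurable[completion ν ((evalSigma d t).comap X)] fun ω => U ω t := by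
    have hXt : ∀ t : I, Measurable[completion ν ((evalSigma d t).comap X)] fun ω => X ω t :=
      fun t => Measurable.mono (ma := (evalSigma d t).comap X)
        ((measurable_eval_evalSigma le_rfl).comp (comap_measurable X))
        le_eventuallyMeasurableSpace le_rfl
    have hzero : ∀ t : I, (∀ᵐ ω ∂ν, h ω t = 0) →
        Measurable[completion ν ((evalSigma d t).comap X)] fun ω => U ω t := by
      intro t ht
      refine measurable_of_eventuallyEq (hXt t) ?_
      filter_upwards [hXU, ht] with ω h1 h2
      simp [h1, h2]
    intro m
    induction m with
    | zero =>
      intro t ht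
      rcases hh t with h0 | ⟨s, hst, -⟩
      · exact hzero t h0
      · have := s.2.1
        simp at ht
        linarith
    | succ m ih =>
      intro t ht
      rcases hh t with h0 | ⟨s, hst, hs⟩
      · exact hzero t h0
      push_cast at ht
      have hs0 := s.2.1
      have ht1 := t.2.2
      -- From `s + δ ≤ t ≤ (m + 1) * (δ / 2)`, the time `r` is within reach of the induction
      -- hypothesis, and it is strictly later than `s`.
      let r : I := ⟨s + δ / 2, by linarith, by linarith⟩
      have hsr : s < r := by rw [← Subtype.coe_lt_coe]; change (s : ℝ) < s + δ / 2; linarith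
      have hrt : r ≤ t := by rw [← Subtype.coe_le_coe]; change (s : ℝ) + δ / 2 ≤ t; linarith
      have hrm : (r : ℝ) ≤ m * (δ / 2) := by change (s : ℝ) + δ / 2 ≤ _; linarith
      have h1 : (evalSigma d r).comap U ≤ completion ν ((evalSigma d t).comap X) :=
        comap_evalSigma_le fun q hq => (ih q ((Subtype.coe_le_coe.2 hq).trans hrm)).mono
          (eventuallyMeasurableSpace_mono (MeasurableSpace.comap_mono
            (evalSigma_mono (hq.trans hrt)))) le_rfl
      have h2 : augFiltration ν s ≤ completion ν ((evalSigma d t).comap X) := by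
        refine eventuallyMeasurableSpace_le_iff.2 ((hU.evalSigmaRight_le s).trans ?_)
        refine eventuallyMeasurableSpace_le_iff.2 (le_trans ?_ h1)
        exact MeasurableSpace.comap_mono (evalSigmaRight_le_evalSigma hsr)
      refine measurable_of_eventuallyEq
        (Measurable.sub (m := completion ν ((evalSigma d t).comap X)) (hXt t) (hs.mono h2 le_rfl)) ?_
      filter_upwards [hXU] with ω h1
      simp [h1]
  have hXad : IsAdapted ν X := hU.1.add (hh.isAdapted hδ)
  refine ⟨isFilteredIso_of_evalSigmaRight_le hXad fun t => (hU.evalSigmaRight_le t).trans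
    (eventuallyMeasurableSpace_le_iff.2 (comap_evalSigmaRight_le (fun t => ?_) t)), ?_⟩
  · obtain ⟨m, hm⟩ := exists_nat_ge ((t : ℝ) / (δ / 2))
    exact (key m t ((div_le_iff₀ (by positivity)).1 hm)).mono (eventuallyMeasurableSpace_mono
      (MeasurableSpace.comap_mono (evalSigma_le_evalSigmaRight t))) le_rfl
  · rw [hU0]
    refine eventuallyMeasurableSpace_comap_congr ?_
    have h0 : ∀ᵐ ω ∂ν, h ω 0 = 0 := by
      rcases hh 0 with h0 | ⟨s, hst, -⟩
      · exact h0
      · have := s.2.1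
        simp at hst
        linarith
    filter_upwards [hXU, h0] with ω h1 h2
    simp [h1, h2]

/-! ### Piecewise linear paths -/

/-- The path `t ↦ (N t - i)` clamped to `[0,1]`, which rises from `0` to `1` on
`[i / N, (i + 1) / N]`. -/
def ramp (N i : ℕ) : C(I, ℝ) :=
  ⟨fun t => max 0 (min 1 (N * (t : ℝ) - i)), by fun_prop⟩

/-- The piecewise linear path with increments `c i` over the intervals `[i / N, (i + 1) / N]`. -/
def interp (N : ℕ) (c : ℕ → EuclideanSpace ℝ (Fin d)) : PathSpace d :=
  ∑ i ∈ Finset.range N, ramp N i • ContinuousMap.const I (c i)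

/-- The derivative of `interp N c`. -/
def interpDeriv (N : ℕ) (c : ℕ → EuclideanSpace ℝ (Fin d)) (s : ℝ) : EuclideanSpace ℝ (Fin d) :=
  ∑ i ∈ Finset.range N, (Ioc ((i : ℝ) / N) ((i + 1 : ℝ) / N)).indicator (fun _ => (N : ℝ) • c i) s

theorem interp_apply (N : ℕ) (c : ℕ → EuclideanSpace ℝ (Fin d)) (t : I) :
    interp N c t = ∑ i ∈ Finset.range N, ramp N i t • c i := by
  simp [interp, ContinuousMap.sum_apply]

theorem ramp_eq_zero {N i : ℕ} {t : I} (h : N * (t : ℝ) ≤ i) : ramp N i t = 0 := by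
  simp only [ramp, ContinuousMap.coe_mk]
  exact max_eq_left ((min_le_right _ _).trans (by linarith))

theorem ramp_one {N i : ℕ} (h : i < N) : ramp N i 1 = 1 := by
  have : (i : ℝ) + 1 ≤ N := by exact_mod_cast h
  simp only [ramp, ContinuousMap.coe_mk, Icc.coe_one]
  rw [min_eq_left (by linarith)]
  simp

theorem integral_indicator_Ioc {N : ℕ} (hN : 0 < N) (i : ℕ) (x : EuclideanSpace ℝ (Fin d)) (t : I) :
    ∫ s in (0 : ℝ)..t, (Ioc ((i : ℝ) / N) ((i + 1 : ℝ) / N)).indicator (fun _ => (N : ℝ) • x) s =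
      ramp N i t • x := by
  have hN' : (0 : ℝ) < N := by exact_mod_cast hN
  have hi : (0 : ℝ) ≤ i / N := by positivity
  rw [intervalIntegral.integral_of_le t.2.1, integral_indicator measurableSet_Ioc,
    Measure.restrict_restrict measurableSet_Ioc, setIntegral_const, Ioc_inter_Ioc, smul_smul]
  congr 1
  simp only [Measure.real, Real.volume_Ioc, ramp, ContinuousMap.coe_mk]
  rw [ENNReal.toReal_ofReal', max_eq_left hi, max_comm, max_mul_of_nonneg _ _ hN'.le,
    sub_mul, min_mul_of_nonneg _ _ hN'.le, div_mul_cancel₀ _ hN'.ne', div_mul_cancel₀ _ hN'.ne',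
    zero_mul]
  congr 1
  rw [← min_sub_sub_right]
  congr 1 <;> ring

theorem isL2Deriv_interp {N : ℕ} (hN : 0 < N) (c : ℕ → EuclideanSpace ℝ (Fin d)) :
    IsL2Deriv (interp N c) (interpDeriv N c) := by
  refine ⟨?_, fun t => ?_⟩
  · unfold interpDeriv
    exact memLp_finsetSum _ fun i _ => (memLp_const _).indicator measurableSet_Ioc
  · simp only [interpDeriv]
    rw [interp_apply, intervalIntegral.integral_finsetSum]
    · exact Finset.sum_congr rfl fun i _ => (integral_indicator_Ioc hN i (c i) t).symm
    · intro i _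
      rw [intervalIntegrable_iff, uIoc_of_le t.2.1]
      exact (integrable_const _).indicator measurableSet_Ioc

theorem exists_mem_Ioc_div {N : ℕ} (hN : 0 < N) {s : ℝ} (h0 : 0 < s) (h1 : s ≤ 1) :
    ∃ j < N, s ∈ Ioc ((j : ℝ) / N) ((j + 1 : ℝ) / N) := by
  have hN' : (0 : ℝ) < N := by exact_mod_cast hN
  have h2 : 0 < ⌈N * s⌉₊ := Nat.ceil_pos.2 (by positivity)
  have h3 : ⌈N * s⌉₊ ≤ N := Nat.ceil_le.2 (by nlinarith)
  obtain ⟨j, hj⟩ := Nat.exists_eq_succ_of_ne_zero h2.ne'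
  refine ⟨j, by omega, ?_, ?_⟩
  · rw [div_lt_iff₀ hN', mul_comm]
    exact Nat.lt_ceil.1 (by omega)
  · rw [le_div_iff₀ hN', mul_comm]
    have := Nat.le_ceil (N * s)
    rw [hj] at this
    exact_mod_cast this

theorem eq_of_mem_Ioc_div {N i j : ℕ} {s : ℝ} (hN : 0 < N)
    (hi : s ∈ Ioc ((i : ℝ) / N) ((i + 1 : ℝ) / N)) (hj : s ∈ Ioc ((j : ℝ) / N) ((j + 1 : ℝ) / N)) :
    i = j := by
  have hN' : (0 : ℝ) < N := by exact_mod_cast hN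
  have h1 := (div_lt_div_iff_of_pos_right hN').1 (hi.1.trans_le hj.2)
  have h2 := (div_lt_div_iff_of_pos_right hN').1 (hj.1.trans_le hi.2)
  norm_cast at h1 h2
  omega

theorem interpDeriv_of_mem {N j : ℕ} (hN : 0 < N) (hj : j < N) (c : ℕ → EuclideanSpace ℝ (Fin d))
    {s : ℝ} (hs : s ∈ Ioc ((j : ℝ) / N) ((j + 1 : ℝ) / N)) :
    interpDeriv N c s = (N : ℝ) • c j := by
  rw [interpDeriv, Finset.sum_eq_single j]
  · rw [indicator_of_mem hs]
  · intro i _ hij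
    exact indicator_of_notMem (fun hi => hij (eq_of_mem_Ioc_div hN hi hs)) _
  · exact fun h => (h (Finset.mem_range.2 hj)).elim

theorem interpDeriv_sub (N : ℕ) (c c' : ℕ → EuclideanSpace ℝ (Fin d)) :
    interpDeriv N (c - c') = interpDeriv N c - interpDeriv N c' := by
  funext s
  simp only [interpDeriv, Pi.sub_apply, ← Finset.sum_sub_distrib]
  refine Finset.sum_congr rfl fun i _ => ?_
  by_cases h : s ∈ Ioc ((i : ℝ) / N) ((i + 1 : ℝ) / N) <;> simp [h, smul_sub]

/-- The slope is `N • c i` on disjoint intervals of length `1 / N`, and `N² / N = N`. -/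
theorem lintegral_interpDeriv_le {N : ℕ} (hN : 0 < N) (c : ℕ → EuclideanSpace ℝ (Fin d)) :
    ∫⁻ s in Icc (0 : ℝ) 1, ‖interpDeriv N c s‖ₑ ^ 2 ≤ ∑ i ∈ Finset.range N, N * ‖c i‖ₑ ^ 2 := by
  have hN' : (0 : ℝ) < N := by exact_mod_cast hN
  calc ∫⁻ s in Icc (0 : ℝ) 1, ‖interpDeriv N c s‖ₑ ^ 2
      ≤ ∫⁻ s, ∑ i ∈ Finset.range N, (Ioc ((i : ℝ) / N) ((i + 1 : ℝ) / N)).indicator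
          (fun _ => (N * ‖c i‖ₑ) ^ 2) s := by
        refine (setLIntegral_le_lintegral _ _).trans (lintegral_mono fun s => ?_)
        by_cases h : ∃ j < N, s ∈ Ioc ((j : ℝ) / N) ((j + 1 : ℝ) / N)
        · obtain ⟨j, hj, hs⟩ := h
          rw [interpDeriv_of_mem hN hj c hs]
          refine le_trans (le_of_eq ?_) (Finset.single_le_sum (fun _ _ => zero_le)
            (Finset.mem_range.2 hj))
          rw [indicator_of_mem hs, enorm_smul, Real.enorm_natCast]
        · push Not at h
          have h0 : interpDeriv N c s = 0 := Finset.sum_eq_zero fun i hi =>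
            indicator_of_notMem (h i (Finset.mem_range.1 hi)) _
          simp [h0]
    _ = ∑ i ∈ Finset.range N, N * ‖c i‖ₑ ^ 2 := by
        rw [lintegral_finsetSum _ fun i _ => measurable_const.indicator measurableSet_Ioc]
        refine Finset.sum_congr rfl fun i _ => ?_
        rw [lintegral_indicator measurableSet_Ioc, setLIntegral_const, Real.volume_Ioc, mul_pow,
          ← sub_div, add_sub_cancel_left, one_div, ENNReal.ofReal_inv_of_pos hN',
          ENNReal.ofReal_natCast, sq (N : ℝ≥0∞), mul_right_comm, mul_assoc (N : ℝ≥0∞),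
          ENNReal.mul_inv_cancel (by exact_mod_cast hN.ne') (by simp), mul_one]

/-! ### Increments of paths in the Cameron-Martin space -/

theorem eLpNorm_two_sq {α E : Type*} [MeasurableSpace α] [NormedAddCommGroup E] (μ : Measure α)
    (g : α → E) : eLpNorm g 2 μ ^ 2 = ∫⁻ s, ‖g s‖ₑ ^ 2 ∂μ := by
  have := eLpNorm_nnreal_pow_eq_lintegral (f := g) (μ := μ) (p := 2) (by norm_num)
  simpa using this

/-- Cauchy–Schwarz, as the comparison of `L¹` and `L²` norms on a finite measure space. -/
theorem enorm_integral_sq_le {g : ℝ → EuclideanSpace ℝ (Fin d)} {a b : ℝ} (hab : a ≤ b)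
    (hg : AEStronglyMeasurable g (volume.restrict (Ioc a b))) :
    ‖∫ s in a..b, g s‖ₑ ^ 2 ≤ ENNReal.ofReal (b - a) * ∫⁻ s in Ioc a b, ‖g s‖ₑ ^ 2 := by
  rw [intervalIntegral.integral_of_le hab]
  have h1 : ‖∫ s in Ioc a b, g s‖ₑ ≤ eLpNorm g 1 (volume.restrict (Ioc a b)) := by
    rw [eLpNorm_one_eq_lintegral_enorm]
    exact enorm_integral_le_lintegral_enorm _
  have h2 := h1.trans (eLpNorm_le_eLpNorm_mul_rpow_measure_univ (p := 1) (q := 2) (by norm_num) hg)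
  calc _ ≤ _ := pow_le_pow_left₀ zero_le h2 2
    _ = _ := by
      rw [mul_pow, eLpNorm_two_sq, mul_comm, ← ENNReal.rpow_natCast, ← ENNReal.rpow_mul]
      norm_num

theorem sum_setLIntegral_Ioc_le (f : ℝ → ℝ≥0∞) {a : ℕ → ℝ} (ha : Monotone a) (n : ℕ) :
    ∑ i ∈ Finset.range n, ∫⁻ s in Ioc (a i) (a (i + 1)), f s ≤ ∫⁻ s in Ioc (a 0) (a n), f s := by
  induction n with
  | zero => simp
  | succ n ih =>
    rw [Finset.sum_range_succ, ← Ioc_union_Ioc_eq_Ioc (ha (Nat.zero_le n)) (ha n.le_succ),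
      lintegral_union measurableSet_Ioc (Ioc_disjoint_Ioc_of_le le_rfl)]
    gcongr

theorem IsL2Deriv.intervalIntegrable {h : PathSpace d} {g : ℝ → EuclideanSpace ℝ (Fin d)}
    (hg : IsL2Deriv h g) (a b : I) : IntervalIntegrable g volume a b := by
  have h1 : IntegrableOn g (Icc 0 1) := hg.1.integrable one_le_two
  refine (intervalIntegrable_iff.2 (h1.mono_set ?_))
  exact uIoc_subset_uIcc.trans (uIcc_subset_Icc a.2 b.2)

theorem IsL2Deriv.sub_eq_integral {h : PathSpace d} {g : ℝ → EuclideanSpace ℝ (Fin d)}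
    (hg : IsL2Deriv h g) (a b : I) : h b - h a = ∫ s in (a : ℝ)..b, g s := by
  rw [hg.2, hg.2]
  exact intervalIntegral.integral_interval_sub_left (hg.intervalIntegrable 0 b)
    (hg.intervalIntegrable 0 a)

theorem IsL2Deriv.sub {h h' : PathSpace d} {g g' : ℝ → EuclideanSpace ℝ (Fin d)}
    (hg : IsL2Deriv h g) (hg' : IsL2Deriv h' g') : IsL2Deriv (h - h') (g - g') := by
  refine ⟨hg.1.sub hg'.1, fun t => ?_⟩
  have := intervalIntegral.integral_sub (hg.intervalIntegrable 0 t) (hg'.intervalIntegrable 0 t)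
  simp only [Icc.coe_zero] at this
  rw [ContinuousMap.sub_apply, hg.2, hg'.2, ← this]
  rfl

theorem IsL2Deriv.cmNorm_le {h : PathSpace d} {g : ℝ → EuclideanSpace ℝ (Fin d)}
    (hg : IsL2Deriv h g) : cmNorm h ≤ eLpNorm g 2 (volume.restrict (Icc (0 : ℝ) 1)) :=
  iInf₂_le g hg

theorem apply_zero_of_mem_cameronMartin {h : PathSpace d} (hh : h ∈ cameronMartin d) : h 0 = 0 := by
  obtain ⟨g, hg⟩ := hh
  simp [hg.2 0]

/-- The energy of a piecewise linear path with increments dominated by those of a path in the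
Cameron-Martin space. -/
theorem eLpNorm_interpDeriv_le {N : ℕ} (hN : 0 < N) {c : ℕ → EuclideanSpace ℝ (Fin d)}
    {g : ℝ → EuclideanSpace ℝ (Fin d)} (hg : MemLp g 2 (volume.restrict (Icc (0 : ℝ) 1)))
    {a : ℕ → I} (ha : Monotone a) (ha3 : ∀ i, (a (i + 1) : ℝ) - a i ≤ 3 / N)
    (hc : ∀ i, ‖c i‖ₑ ≤ ‖∫ s in (a i : ℝ)..a (i + 1), g s‖ₑ) :
    eLpNorm (interpDeriv N c) 2 (volume.restrict (Icc (0 : ℝ) 1)) ≤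
      2 * eLpNorm g 2 (volume.restrict (Icc (0 : ℝ) 1)) := by
  have hN' : (0 : ℝ) < N := by exact_mod_cast hN
  have hsub : ∀ i j, Ioc (a i : ℝ) (a j) ⊆ Icc 0 1 := fun i j s hs =>
    ⟨(a i).2.1.trans hs.1.le, hs.2.trans (a j).2.2⟩
  refine (ENNReal.pow_le_pow_left_iff two_ne_zero).1 ?_
  rw [mul_pow, eLpNorm_two_sq, eLpNorm_two_sq]
  calc _ ≤ ∑ i ∈ Finset.range N, N * ‖c i‖ₑ ^ 2 := lintegral_interpDeriv_le hN c
    _ ≤ ∑ i ∈ Finset.range N, 3 * ∫⁻ s in Ioc (a i : ℝ) (a (i + 1)), ‖g s‖ₑ ^ 2 := by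
        refine Finset.sum_le_sum fun i _ => ?_
        calc (N : ℝ≥0∞) * ‖c i‖ₑ ^ 2 ≤ N * (ENNReal.ofReal (3 / N) *
              ∫⁻ s in Ioc (a i : ℝ) (a (i + 1)), ‖g s‖ₑ ^ 2) := by
              refine mul_le_mul_right ?_ _
              refine (pow_le_pow_left₀ zero_le (hc i) 2).trans ?_
              refine (enorm_integral_sq_le (ha i.le_succ)
                (hg.1.mono_measure (Measure.restrict_mono (hsub _ _) le_rfl))).trans ?_
              gcongr
              exact ha3 i
          _ = _ := by
              rw [← mul_assoc, ← ENNReal.ofReal_natCast, ← ENNReal.ofReal_mul hN'.le,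
                mul_div_cancel₀ _ hN'.ne']
              simp
    _ ≤ 3 * ∫⁻ s in Icc (0 : ℝ) 1, ‖g s‖ₑ ^ 2 := by
        rw [← Finset.mul_sum]
        gcongr
        exact (sum_setLIntegral_Ioc_le _ (a := fun i => (a i : ℝ)) (fun i j h => ha h) N).trans
          (lintegral_mono_set (hsub _ _))
    -- The sharper constant `√3` is rounded up to `2`, since `3 ≤ 2 ^ 2`.
    _ ≤ _ := by
        gcongr
        norm_num

/-! ### The delayed grid -/

/-- The grid `i ↦ (i - 2) / N`, delayed by two steps; if `z` holds, it is sent to `1` from the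
index `N` on. -/
def delayedNode (z : Prop) (N i : ℕ) : I :=
  open Classical in if z ∧ N ≤ i then 1 else projIcc 0 1 zero_le_one (((i - 2 : ℕ) : ℝ) / N)

theorem delayedNode_of_not {z : Prop} {N i : ℕ} (h : ¬ (z ∧ N ≤ i)) (hi : i ≤ N + 2) :
    (delayedNode z N i : ℝ) = ((i - 2 : ℕ) : ℝ) / N := by
  rw [delayedNode, if_neg h, projIcc_of_mem]
  refine ⟨by positivity, div_le_one_of_le₀ ?_ (by positivity)⟩
  exact_mod_cast (by omega : i - 2 ≤ N)

theorem delayedNode_one {z : Prop} {N i : ℕ} (h : z ∧ N ≤ i) : delayedNode z N i = 1 := if_pos h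

theorem delayedNode_monotone (z : Prop) (N : ℕ) : Monotone (delayedNode z N) := by
  intro i j hij
  by_cases hj : z ∧ N ≤ j
  · rw [delayedNode_one hj]; exact unitInterval.le_one'
  have hi : ¬ (z ∧ N ≤ i) := fun h => hj ⟨h.1, h.2.trans hij⟩
  rw [delayedNode, delayedNode, if_neg hi, if_neg hj]
  refine monotone_projIcc _ ?_
  gcongr

theorem delayedNode_zero {z : Prop} {N : ℕ} (hN : 0 < N) : delayedNode z N 0 = 0 := by
  apply Subtype.ext
  rw [delayedNode_of_not (by omega) (by omega)]
  simp

/-- Ordinary steps are at most `1 / N`. The constant `3` pays for the jump to `1` at index `N`,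
which makes up the delay of two steps. -/
theorem delayedNode_succ_sub_le (z : Prop) {N : ℕ} (hN : 0 < N) (i : ℕ) :
    (delayedNode z N (i + 1) : ℝ) - delayedNode z N i ≤ 3 / N := by
  have hN' : (0 : ℝ) < N := by exact_mod_cast hN
  by_cases hi : z ∧ N ≤ i
  · rw [delayedNode_one hi, delayedNode_one ⟨hi.1, hi.2.trans i.le_succ⟩, sub_self]
    positivity
  by_cases hj : z ∧ N ≤ i + 1
  · have hiN : i + 1 = N := by
      have := hj.2
      have : ¬ N ≤ i := fun h => hi ⟨hj.1, h⟩
      omega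
    rw [delayedNode_one hj, delayedNode_of_not hi (by omega), Icc.coe_one, ← hiN,
      sub_le_iff_le_add, ← add_div, le_div_iff₀ (by positivity), one_mul]
    exact_mod_cast (by omega : i + 1 ≤ 3 + (i - 2))
  · rw [delayedNode, delayedNode, if_neg hi, if_neg hj]
    have h1 := abs_projIcc_sub_projIcc (a := (0 : ℝ)) (b := 1)
      (c := ((i + 1 - 2 : ℕ) : ℝ) / N) (d := ((i - 2 : ℕ) : ℝ) / N) zero_le_one
    refine (le_abs_self _).trans (h1.trans ?_)
    rw [← sub_div, abs_div, abs_of_pos hN']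
    gcongr
    rw [abs_le]
    have h2 : ((i - 2 : ℕ) : ℝ) ≤ ((i + 1 - 2 : ℕ) : ℝ) := by exact_mod_cast (by omega)
    have h3 : ((i + 1 - 2 : ℕ) : ℝ) ≤ ((i - 2 : ℕ) : ℝ) + 1 := by exact_mod_cast (by omega)
    constructor <;> linarith

/-! ### Strong convergence of the delayed discretizations -/

/-- For large `N` the value at `s` is the mean of `g` over an interval of length `1 / N` within `3 /
N` of `s`. An interior `s` eventually avoids both the stopped start of the grid and its modified
end. -/
theorem tendsto_interpDeriv_apply (z : Prop) {g : ℝ → EuclideanSpace ℝ (Fin d)}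
    (hg : Continuous g) {s : ℝ} (hs : s ∈ Ioo (0 : ℝ) 1) :
    Tendsto (fun N : ℕ => interpDeriv N (fun i =>
      ∫ r in (delayedNode z N i : ℝ)..delayedNode z N (i + 1), g r) s) atTop (𝓝 (g s)) := by
  rw [Metric.tendsto_atTop]
  intro ε hε
  obtain ⟨η, hη, hgη⟩ := Metric.continuous_iff.1 hg s (ε / 2) (by positivity)
  -- Once `4 / N` is below this minimum, the averaging interval is in the `η`-ball around `s`, and
  -- the index `j` satisfies `2 ≤ j` and `j + 1 < N`.
  have hη' : 0 < min η (min s (1 - s)) := lt_min hη (lt_min hs.1 (by linarith [hs.2]))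
  obtain ⟨M, hM⟩ := exists_nat_gt (4 / min η (min s (1 - s)))
  refine ⟨M, fun N hN => ?_⟩
  have hN1 : 4 / min η (min s (1 - s)) < N := hM.trans_le (by exact_mod_cast hN)
  have hN' : (0 : ℝ) < N := lt_trans (by positivity) hN1
  have hN0 : 0 < N := by exact_mod_cast hN'
  rw [div_lt_iff₀ hη'] at hN1
  have hNη : 4 < N * η := hN1.trans_le (by gcongr; exact min_le_left _ _)
  have hNs : 4 < N * s := hN1.trans_le (by
    gcongr; exact (min_le_right _ _).trans (min_le_left _ _))
  have hNs' : 4 < N * (1 - s) := hN1.trans_le (by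
    gcongr; exact (min_le_right _ _).trans (min_le_right _ _))
  obtain ⟨j, hj, hjs⟩ := exists_mem_Ioc_div hN0 hs.1 hs.2.le
  rw [interpDeriv_of_mem hN0 hj _ hjs]
  obtain ⟨h1, h2⟩ := hjs
  rw [div_lt_iff₀ hN'] at h1
  rw [le_div_iff₀ hN'] at h2
  have hj2 : 2 ≤ j := by
    have : (2 : ℝ) < j := by linarith
    exact_mod_cast this.le
  have hjN : j + 1 < N := by
    have : (j : ℝ) + 1 < N := by linarith
    exact_mod_cast this
  rw [delayedNode_of_not (by omega) (by omega), delayedNode_of_not (by omega) (by omega)]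
  have e1 : ((j - 2 : ℕ) : ℝ) = j - 2 := by push_cast [hj2]; ring
  have e2 : ((j + 1 - 2 : ℕ) : ℝ) = j - 1 := by
    rw [show j + 1 - 2 = j - 1 by omega]; push_cast [show 1 ≤ j by omega]; ring
  rw [e1, e2, dist_eq_norm]
  have h3 : (N : ℝ) • (∫ r in ((j - 2 : ℝ) / N)..((j - 1 : ℝ) / N), g r) - g s =
      (N : ℝ) • ∫ r in ((j - 2 : ℝ) / N)..((j - 1 : ℝ) / N), (g r - g s) := by
    rw [intervalIntegral.integral_sub (hg.intervalIntegrable _ _) (by simp),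
      intervalIntegral.integral_const, smul_sub, smul_smul]
    congr 1
    rw [← sub_div, mul_div_cancel₀ _ hN'.ne', show (j - 1 - (j - 2) : ℝ) = 1 by ring, one_smul]
  have h4 : ‖∫ r in ((j - 2 : ℝ) / N)..((j - 1 : ℝ) / N), (g r - g s)‖ ≤
      (ε / 2) * |(j - 1 : ℝ) / N - (j - 2 : ℝ) / N| := by
    refine intervalIntegral.norm_integral_le_of_norm_le_const fun r hr => ?_
    rw [uIoc_of_le (by gcongr; norm_num)] at hr
    rw [← dist_eq_norm]
    refine (hgη r ?_).le
    obtain ⟨hr1, hr2⟩ := hr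
    rw [div_lt_iff₀ hN'] at hr1
    rw [le_div_iff₀ hN'] at hr2
    rw [Real.dist_eq, abs_lt]
    constructor
    · by_contra! hcon
      nlinarith
    · by_contra! hcon
      nlinarith
  rw [h3, norm_smul, Real.norm_natCast]
  calc _ ≤ (N : ℝ) * ((ε / 2) * |(j - 1 : ℝ) / N - (j - 2 : ℝ) / N|) := by gcongr
    _ = ε / 2 := by
      rw [← sub_div, show (j - 1 - (j - 2) : ℝ) = 1 by ring, abs_of_pos (by positivity)]
      field_simp
    _ < ε := by linarith

theorem norm_interpDeriv_le (z : Prop) {g : ℝ → EuclideanSpace ℝ (Fin d)} {C : ℝ}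
    (hC : ∀ r, ‖g r‖ ≤ C) {N : ℕ} (hN : 0 < N) {s : ℝ} (hs : s ∈ Ioo (0 : ℝ) 1) :
    ‖interpDeriv N (fun i =>
      ∫ r in (delayedNode z N i : ℝ)..delayedNode z N (i + 1), g r) s‖ ≤ 3 * C := by
  have hN' : (0 : ℝ) < N := by exact_mod_cast hN
  obtain ⟨j, hj, hjs⟩ := exists_mem_Ioc_div hN hs.1 hs.2.le
  rw [interpDeriv_of_mem hN hj _ hjs, norm_smul, Real.norm_natCast]
  have h1 := intervalIntegral.norm_integral_le_of_norm_le_const (f := g) (C := C)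
    (a := delayedNode z N j) (b := delayedNode z N (j + 1)) fun r _ => hC r
  rw [abs_of_nonneg (sub_nonneg.2 (Subtype.coe_le_coe.2 (delayedNode_monotone z N j.le_succ)))] at h1
  have h2 := delayedNode_succ_sub_le z hN j
  have hC0 : 0 ≤ C := (norm_nonneg _).trans (hC 0)
  calc _ ≤ (N : ℝ) * (C * (3 / N)) := by gcongr; exact h1.trans (by gcongr)
    _ = 3 * C := by field_simp

/-- Dominated convergence: the difference is at most `3 * C + C` on the open interval. -/
theorem tendsto_eLpNorm_interpDeriv_sub_of_continuous (z : Prop)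
    {g : ℝ → EuclideanSpace ℝ (Fin d)} (hg : Continuous g) {C : ℝ} (hC : ∀ r, ‖g r‖ ≤ C) :
    Tendsto (fun N : ℕ => eLpNorm (interpDeriv N (fun i =>
      ∫ r in (delayedNode z N i : ℝ)..delayedNode z N (i + 1), g r) - g) 2
        (volume.restrict (Icc (0 : ℝ) 1))) atTop (𝓝 0) := by
  set F := fun N : ℕ => interpDeriv N (fun i =>
      ∫ r in (delayedNode z N i : ℝ)..delayedNode z N (i + 1), g r) with hF
  have hC0 : 0 ≤ C := (norm_nonneg _).trans (hC 0)
  have hmeas : ∀ N, Measurable (F N) := fun N => by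
    simp only [hF]
    unfold interpDeriv
    exact Finset.measurable_fun_sum _ fun i _ => measurable_const.indicator measurableSet_Ioc
  have hae : ∀ᵐ s ∂(volume.restrict (Icc (0 : ℝ) 1)), s ∈ Ioo (0 : ℝ) 1 := by
    rw [← restrict_Ioo_eq_restrict_Icc]
    exact ae_restrict_mem measurableSet_Ioo
  have h1 : Tendsto (fun N => ∫⁻ s in Icc (0 : ℝ) 1, ‖(F N - g) s‖ₑ ^ 2) atTop
      (𝓝 (∫⁻ _ in Icc (0 : ℝ) 1, 0)) := by
    refine tendsto_lintegral_filter_of_dominated_convergence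
      (fun _ => ENNReal.ofReal (4 * C) ^ 2) ?_ ?_ ?_ ?_
    · exact .of_forall fun N => (((hmeas N).sub hg.measurable).enorm.pow_const 2)
    · filter_upwards [eventually_gt_atTop 0] with N hN
      filter_upwards [hae] with s hs
      refine pow_le_pow_left₀ zero_le ?_ 2
      rw [← ofReal_norm]
      refine ENNReal.ofReal_le_ofReal ((norm_sub_le _ _).trans ?_)
      linarith [norm_interpDeriv_le z hC hN hs, hC s]
    · rw [lintegral_const]
      simp
      finiteness
    · filter_upwards [hae] with s hs
      have h2 := ((tendsto_interpDeriv_apply z hg hs).sub_const (g s)).enorm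
      rw [sub_self, enorm_zero] at h2
      simpa using ENNReal.Tendsto.pow h2 (n := 2)
  have h2 := h1.ennrpow_const (1 / 2 : ℝ)
  simp only [lintegral_zero] at h2
  rw [ENNReal.zero_rpow_of_pos (by norm_num)] at h2
  refine h2.congr fun N => ?_
  rw [← eLpNorm_two_sq, ← ENNReal.rpow_natCast, ← ENNReal.rpow_mul]
  norm_num [hF]

/-- Uniformly bounded linear operators that converge on a dense subspace, here the compactly
supported continuous functions, converge strongly. -/
theorem tendsto_eLpNorm_interpDeriv_sub (z : Prop) {g : ℝ → EuclideanSpace ℝ (Fin d)}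
    (hg : MemLp g 2 (volume.restrict (Icc (0 : ℝ) 1))) :
    Tendsto (fun N : ℕ => eLpNorm (interpDeriv N (fun i =>
      ∫ r in (delayedNode z N i : ℝ)..delayedNode z N (i + 1), g r) - g) 2
        (volume.restrict (Icc (0 : ℝ) 1))) atTop (𝓝 0) := by
  set μ := volume.restrict (Icc (0 : ℝ) 1) with hμ
  rw [ENNReal.tendsto_nhds_zero]
  intro ε hε
  -- The budget is `2 * δ` for the discretization of `g - f`, `δ` for the convergence at `f`, and
  -- `δ` for `f - g`.
  obtain ⟨δ, hδ, hδε⟩ : ∃ δ : ℝ≥0∞, δ ≠ 0 ∧ 4 * δ ≤ ε :=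
    ⟨ε / 4, (ENNReal.div_pos hε.ne' (by norm_num)).ne', ENNReal.mul_div_le⟩
  obtain ⟨f, hfc, hfδ, hf, hfm⟩ := hg.exists_hasCompactSupport_eLpNorm_sub_le (by norm_num) hδ
  obtain ⟨C, hC⟩ := hfc.exists_bound_of_continuous hf
  have h1 := tendsto_eLpNorm_interpDeriv_sub_of_continuous z hf hC
  filter_upwards [eventually_gt_atTop 0, ENNReal.tendsto_nhds_zero.1 h1 δ (pos_iff_ne_zero.2 hδ)]
    with N hN h2
  set a := delayedNode z N
  have hint : ∀ {f : ℝ → EuclideanSpace ℝ (Fin d)}, MemLp f 2 μ → ∀ i,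
      IntervalIntegrable f volume (a i) (a (i + 1)) := by
    intro f hf i
    have h1 : IntegrableOn f (Icc 0 1) := hf.integrable one_le_two
    exact intervalIntegrable_iff.2
      (h1.mono_set (uIoc_subset_uIcc.trans (uIcc_subset_Icc (a i).2 (a (i + 1)).2)))
  have hmem : ∀ c : ℕ → EuclideanSpace ℝ (Fin d), AEStronglyMeasurable (interpDeriv N c) μ :=
    fun c => (isL2Deriv_interp hN c).1.1
  have h3 : eLpNorm (interpDeriv N (fun i => ∫ r in (a i : ℝ)..a (i + 1), g r) -
      interpDeriv N (fun i => ∫ r in (a i : ℝ)..a (i + 1), f r)) 2 μ ≤ 2 * δ := by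
    rw [← interpDeriv_sub]
    refine (eLpNorm_interpDeriv_le hN (hg.sub hfm) (delayedNode_monotone z N)
      (delayedNode_succ_sub_le z hN) fun i => ?_).trans (by gcongr)
    refine le_of_eq (congrArg _ ?_)
    exact (intervalIntegral.integral_sub (hint hg i) (hint hfm i)).symm
  have h4 : eLpNorm (f - g) 2 μ ≤ δ := by rwa [eLpNorm_sub_comm]
  calc _ ≤ 2 * δ + (δ + δ) := by
        rw [← sub_add_sub_cancel _ (interpDeriv N (fun i => ∫ r in (a i : ℝ)..a (i + 1), f r)) g,
          ← sub_add_sub_cancel (interpDeriv N (fun i => ∫ r in (a i : ℝ)..a (i + 1), f r)) f g]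
        refine (eLpNorm_add_le ((hmem _).sub (hmem _)) (((hmem _).sub hfm.1).add (hfm.1.sub hg.1))
          one_le_two).trans (add_le_add h3 ?_)
        exact (eLpNorm_add_le ((hmem _).sub hfm.1) (hfm.1.sub hg.1) one_le_two).trans
          (add_le_add h2 h4)
    _ = 4 * δ := by ring
    _ ≤ ε := hδε

/-! ### Measurability of the Cameron-Martin norm -/

/-- The primitive of a square integrable function. -/
def primitive (f : Lp (EuclideanSpace ℝ (Fin d)) 2 (volume.restrict (Icc (0 : ℝ) 1))) :
    PathSpace d where
  toFun t := ∫ s in (0 : ℝ)..t, f s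
  continuous_toFun := by
    have h : IntegrableOn f (Icc (0 : ℝ) 1) := (Lp.memLp f).integrable one_le_two
    have h1 := intervalIntegral.continuousOn_primitive_interval (μ := volume) (f := f)
      (a := 0) (b := 1) (by rwa [uIcc_of_le zero_le_one])
    rw [uIcc_of_le zero_le_one] at h1
    exact continuousOn_iff_continuous_domRestrict.1 h1

theorem isL2Deriv_primitive
    (f : Lp (EuclideanSpace ℝ (Fin d)) 2 (volume.restrict (Icc (0 : ℝ) 1))) :
    IsL2Deriv (primitive f) f := ⟨Lp.memLp f, fun _ => rfl⟩

/-- A path in the Cameron-Martin space is bounded by the norm of its derivative. -/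
theorem IsL2Deriv.enorm_apply_le {h : PathSpace d} {g : ℝ → EuclideanSpace ℝ (Fin d)}
    (hg : IsL2Deriv h g) (t : I) : ‖h t‖ₑ ≤ eLpNorm g 2 (volume.restrict (Icc (0 : ℝ) 1)) := by
  have hsub : Ioc (0 : ℝ) t ⊆ Icc 0 1 := fun s hs => ⟨hs.1.le, hs.2.trans t.2.2⟩
  refine (ENNReal.pow_le_pow_left_iff two_ne_zero).1 ?_
  rw [hg.2 t, eLpNorm_two_sq]
  refine (enorm_integral_sq_le t.2.1
    (hg.1.1.mono_measure (Measure.restrict_mono hsub le_rfl))).trans ?_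
  calc _ ≤ 1 * ∫⁻ s in Icc (0 : ℝ) 1, ‖g s‖ₑ ^ 2 := by
        gcongr
        · exact ENNReal.ofReal_le_one.2 (by linarith [t.2.2])
    _ = _ := one_mul _

theorem continuous_primitive : Continuous (primitive (d := d)) := by
  refine LipschitzWith.continuous (K := 1) fun f f' => ?_
  rw [edist_eq_enorm_sub, edist_eq_enorm_sub, ENNReal.coe_one, one_mul, Lp.enorm_def,
    eLpNorm_congr_ae (Lp.coeFn_sub f f')]
  have h := ((isL2Deriv_primitive f).sub (isL2Deriv_primitive f')).enorm_apply_le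
  have hfin : eLpNorm (⇑f - ⇑f') 2 (volume.restrict (Icc (0 : ℝ) 1)) < ∞ :=
    ((Lp.memLp f).sub (Lp.memLp f')).2
  rw [← ofReal_norm, ENNReal.ofReal_le_iff_le_toReal hfin.ne,
    ContinuousMap.norm_le _ ENNReal.toReal_nonneg]
  intro t
  rw [← ENNReal.ofReal_le_iff_le_toReal hfin.ne, ofReal_norm]
  exact h t

/-- Lebesgue differentiation of the zero primitive. -/
theorem ae_eq_zero_of_intervalIntegral_eq_zero {E : Type*} [NormedAddCommGroup E] [NormedSpace ℝ E]
    [CompleteSpace E] {g : ℝ → E} (hg : IntegrableOn g (Icc 0 1))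
    (h : ∀ t ∈ Icc (0 : ℝ) 1, ∫ s in (0 : ℝ)..t, g s = 0) :
    g =ᵐ[volume.restrict (Icc (0 : ℝ) 1)] 0 := by
  have h1 : IntervalIntegrable g volume 0 1 := by
    rw [intervalIntegrable_iff, uIoc_of_le zero_le_one]
    exact hg.mono_set Ioc_subset_Icc_self
  rw [← restrict_Ioo_eq_restrict_Icc]
  refine (ae_restrict_iff' measurableSet_Ioo).2 ?_
  filter_upwards [h1.ae_hasDerivAt_integral] with s hs hs01
  have hs' : s ∈ uIcc (0 : ℝ) 1 := by
    rw [uIcc_of_le zero_le_one]; exact Ioo_subset_Icc_self hs01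
  have h2 := hs hs' 0 left_mem_uIcc
  have h3 : (fun x => ∫ t in (0 : ℝ)..x, g t) =ᶠ[𝓝 s] fun _ => 0 := by
    filter_upwards [isOpen_Ioo.mem_nhds hs01] with t ht
    exact h t (Ioo_subset_Icc_self ht)
  exact h2.unique ((hasDerivAt_const s 0).congr_of_eventuallyEq h3)

theorem injective_primitive : Function.Injective (primitive (d := d)) := by
  intro f f' hff
  have h1 : ∀ t ∈ Icc (0 : ℝ) 1, ∫ s in (0 : ℝ)..t, (⇑f - ⇑f') s = 0 := by
    intro t ht
    have := ((isL2Deriv_primitive f).sub (isL2Deriv_primitive f')).2 ⟨t, ht⟩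
    rw [hff, sub_self] at this
    exact this.symm
  have h2 := ae_eq_zero_of_intervalIntegral_eq_zero
    (((Lp.memLp f).sub (Lp.memLp f')).integrable one_le_two) h1
  exact Lp.ext (h2.mono fun s hs => sub_eq_zero.1 hs)

/-- Each strict sublevel set is the image of an open ball of the Polish space `L²` under the
continuous injection `primitive`, hence Borel by Lusin–Souslin. -/
theorem measurable_cmNorm : Measurable (cmNorm (d := d)) := by
  let _ : MeasurableSpace (Lp (EuclideanSpace ℝ (Fin d)) 2 (volume.restrict (Icc (0 : ℝ) 1))) :=
    borel _
  have : BorelSpace (Lp (EuclideanSpace ℝ (Fin d)) 2 (volume.restrict (Icc (0 : ℝ) 1))) := ⟨rfl⟩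
  refine measurable_of_Iio fun c => ?_
  have hset : cmNorm (d := d) ⁻¹' Iio c = primitive '' {f | ‖f‖ₑ < c} := by
    ext h
    simp only [mem_preimage, mem_Iio, cmNorm, iInf_lt_iff, mem_image, mem_ofPred_eq]
    constructor
    · rintro ⟨g, hg, hgc⟩
      refine ⟨hg.1.toLp g, ?_, ?_⟩
      · rwa [Lp.enorm_def, eLpNorm_congr_ae hg.1.coeFn_toLp]
      · ext1 t
        rw [hg.2 t]
        refine intervalIntegral.integral_congr_ae_restrict ?_
        rw [uIoc_of_le t.2.1]
        have hsub : Ioc (0 : ℝ) t ⊆ Icc 0 1 := fun s hs => ⟨hs.1.le, hs.2.trans t.2.2⟩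
        exact ae_mono (Measure.restrict_mono hsub le_rfl) hg.1.coeFn_toLp
    · rintro ⟨f, hf, rfl⟩
      exact ⟨f, isL2Deriv_primitive f, by rwa [Lp.enorm_def] at hf⟩
  rw [hset]
  have : Fact ((2 : ℝ≥0∞) ≠ ∞) := ⟨by norm_num⟩
  exact (isOpen_lt continuous_enorm continuous_const).measurableSet.image_of_continuousOn_injOn
    continuous_primitive.continuousOn injective_primitive.injOn

/-! ### Bounded delayed discretizations -/

/-- The coordinatewise clamp to `[-K, K]`. -/
def clamp (K : ℝ) (x : EuclideanSpace ℝ (Fin d)) : EuclideanSpace ℝ (Fin d) :=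
  WithLp.toLp 2 fun i => max (-K) (min K (x i))

theorem continuous_clamp (K : ℝ) : Continuous (clamp (d := d) K) := by
  unfold clamp; fun_prop

theorem norm_clamp_sub_le (K : ℝ) (x y : EuclideanSpace ℝ (Fin d)) :
    ‖clamp K x - clamp K y‖ ≤ ‖x - y‖ := by
  rw [EuclideanSpace.norm_eq, EuclideanSpace.norm_eq]
  gcongr with i
  simp only [clamp, PiLp.sub_apply, Real.norm_eq_abs]
  refine (abs_max_sub_max_le_max _ _ _ _).trans ?_
  rw [sub_self, abs_zero, max_eq_right (abs_nonneg _)]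
  refine (abs_min_sub_min_le_max _ _ _ _).trans ?_
  rw [sub_self, abs_zero, max_eq_right (abs_nonneg _)]

theorem clamp_of_norm_le {K : ℝ} {x : EuclideanSpace ℝ (Fin d)} (h : ‖x‖ ≤ K) : clamp K x = x := by
  ext i
  have h1 := abs_le.1 ((PiLp.norm_apply_le x i).trans h)
  simp [clamp, h1.1, h1.2]

theorem norm_clamp_le {K : ℝ} (hK : 0 ≤ K) (x : EuclideanSpace ℝ (Fin d)) :
    ‖clamp K x‖ ≤ √d * K := by
  rw [EuclideanSpace.norm_eq, ← Real.sqrt_sq hK, ← Real.sqrt_mul (Nat.cast_nonneg d),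
    Real.sqrt_sq hK]
  refine Real.sqrt_le_sqrt ?_
  refine (Finset.sum_le_card_nsmul _ _ (K ^ 2) fun i _ => ?_).trans (by simp)
  rw [Real.norm_eq_abs, sq_abs, sq_le_sq, abs_of_nonneg hK, abs_le]
  exact ⟨le_max_left _ _, max_le (by linarith) (min_le_left _ _)⟩

/-- The increments of the path `w`, clamped to `[-N, N]^d`, along the delayed grid. -/
def delayedIncr (z : Prop) (N : ℕ) (w : PathSpace d) (i : ℕ) : EuclideanSpace ℝ (Fin d) :=
  clamp N (w (delayedNode z N (i + 1))) - clamp N (w (delayedNode z N i))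

/-- The bounded, delayed, piecewise linear approximation of `w`. -/
def delayedInterp (z : Prop) (N : ℕ) (w : PathSpace d) : PathSpace d :=
  interp N (delayedIncr z N w)

theorem continuous_delayedInterp (z : Prop) (N : ℕ) :
    Continuous (delayedInterp (d := d) z N) := by
  refine ContinuousMap.continuous_of_continuous_uncurry _ ?_
  simp only [Function.uncurry_def, delayedInterp, interp_apply, delayedIncr]
  have h1 : ∀ a : I, Continuous fun p : PathSpace d × I => clamp N (p.1 a) := fun a =>
    (continuous_clamp N).comp ((continuous_eval_const a).comp continuous_fst)
  exact continuous_finsetSum _ fun i _ =>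
    ((ramp N i).continuous.comp continuous_snd).smul ((h1 _).sub (h1 _))

theorem delayedInterp_zero {z : Prop} {N : ℕ} (w : PathSpace d) : delayedInterp z N w 0 = 0 := by
  rw [delayedInterp, interp_apply]
  exact Finset.sum_eq_zero fun i _ => by rw [ramp_eq_zero (by simp), zero_smul]

/-- At time `1` every ramp is complete, so the increments telescope. -/
theorem delayedInterp_one {z : Prop} {N : ℕ} (w : PathSpace d) :
    delayedInterp z N w 1 = clamp N (w (delayedNode z N N)) - clamp N (w (delayedNode z N 0)) := by
  rw [delayedInterp, interp_apply, ← Finset.sum_range_sub fun i => clamp N (w (delayedNode z N i))]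
  exact Finset.sum_congr rfl fun i hi => by
    rw [ramp_one (Finset.mem_range.1 hi), one_smul, delayedIncr]

theorem delayedInterp_mem_cameronMartin {z : Prop} {N : ℕ} (hN : 0 < N) (w : PathSpace d) :
    delayedInterp z N w ∈ cameronMartin d := ⟨_, isL2Deriv_interp hN _⟩

theorem delayedInterp_mem_cameronMartinZero {N : ℕ} (hN : 0 < N) {w : PathSpace d}
    (h0 : w 0 = 0) (h1 : w 1 = 0) : delayedInterp True N w ∈ cameronMartinZero d := by
  refine ⟨delayedInterp_mem_cameronMartin hN w, ?_⟩
  rw [delayedInterp_one, delayedNode_one ⟨trivial, le_rfl⟩, delayedNode_zero hN, h0, h1, sub_self]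

theorem norm_delayedIncr_le (z : Prop) (N : ℕ) (w : PathSpace d) (i : ℕ) :
    ‖delayedIncr z N w i‖ ≤ 2 * (√d * N) := by
  have h := fun x => norm_clamp_le (d := d) (Nat.cast_nonneg N) x
  refine (norm_sub_le _ _).trans ?_
  linarith [h (w (delayedNode z N (i + 1))), h (w (delayedNode z N i))]

theorem exists_cmNorm_delayedInterp_lt (d : ℕ) (z : Prop) {N : ℕ} (hN : 0 < N) :
    ∃ K : ℝ, 0 < K ∧ ∀ w : PathSpace d, cmNorm (delayedInterp z N w) < ENNReal.ofReal K := by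
  refine ⟨N * (2 * (√d * N)) + 1, by positivity, fun w => ?_⟩
  refine ((isL2Deriv_interp hN _).cmNorm_le.trans (eLpNorm_le_of_ae_bound
    (C := N * (2 * (√d * N))) ?_)).trans_lt ?_
  · refine .of_forall fun s => ?_
    by_cases h : ∃ j < N, s ∈ Ioc ((j : ℝ) / N) ((j + 1 : ℝ) / N)
    · obtain ⟨j, hj, hs⟩ := h
      rw [interpDeriv_of_mem hN hj _ hs, norm_smul, Real.norm_natCast]
      gcongr
      exact norm_delayedIncr_le z N w j
    · push Not at h
      have h0 : interpDeriv N (delayedIncr z N w) s = 0 := Finset.sum_eq_zero fun i hi =>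
        indicator_of_notMem (h i (Finset.mem_range.1 hi)) _
      rw [h0, norm_zero]
      positivity
  · simp only [Measure.restrict_apply_univ, Real.volume_Icc, sub_zero, ENNReal.ofReal_one,
      ENNReal.one_rpow, one_mul]
    exact (ENNReal.ofReal_lt_ofReal_iff (by positivity)).2 (lt_add_one _)

theorem norm_delayedInterp_lt (z : Prop) (N : ℕ) (w : PathSpace d) :
    ‖delayedInterp z N w‖ < N * (2 * (√d * N)) + 1 := by
  refine lt_of_le_of_lt ((ContinuousMap.norm_le _ (by positivity)).2 fun t => ?_) (lt_add_one _)
  rw [delayedInterp, interp_apply]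
  refine (norm_sum_le_of_le (n := fun _ => 2 * (√d * N)) _ fun i _ => ?_).trans (by simp)
  rw [norm_smul]
  have h1 : ‖ramp N i t‖ ≤ 1 := by
    simp only [ramp, ContinuousMap.coe_mk, Real.norm_eq_abs]
    rw [abs_of_nonneg (le_max_left _ _)]
    exact max_le zero_le_one (min_le_left _ _)
  calc _ ≤ 1 * (2 * (√d * N)) := by gcongr; exact norm_delayedIncr_le z N w i
    _ = _ := one_mul _

theorem enorm_delayedIncr_le {z : Prop} {N : ℕ} {w : PathSpace d}
    {g : ℝ → EuclideanSpace ℝ (Fin d)} (hg : IsL2Deriv w g) (i : ℕ) :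
    ‖delayedIncr z N w i‖ₑ ≤
      ‖∫ s in (delayedNode z N i : ℝ)..delayedNode z N (i + 1), g s‖ₑ := by
  rw [← hg.sub_eq_integral, ← ofReal_norm, ← ofReal_norm]
  exact ENNReal.ofReal_le_ofReal (norm_clamp_sub_le _ _ _)

/-- The factor is `1 + 2`, with `2` the uniform operator bound. Being independent of `N`, it
supplies the dominating function over `ν`. -/
theorem cmNorm_sub_delayedInterp_le (z : Prop) {N : ℕ} (hN : 0 < N) (w : PathSpace d) :
    cmNorm (w - delayedInterp z N w) ≤ 3 * cmNorm w := by
  have hne : (3 : ℝ≥0∞) ≠ 0 := by norm_num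
  rw [mul_comm, ← ENNReal.div_le_iff_le_mul (.inl hne) (.inl (by norm_num))]
  refine le_iInf₂ fun g hg => ?_
  rw [ENNReal.div_le_iff_le_mul (.inl hne) (.inl (by norm_num)), mul_comm]
  have hi := isL2Deriv_interp hN (delayedIncr z N w)
  refine (hg.sub hi).cmNorm_le.trans ((eLpNorm_sub_le hg.1.1 hi.1.1 one_le_two).trans ?_)
  calc _ ≤ eLpNorm g 2 (volume.restrict (Icc (0 : ℝ) 1)) +
        2 * eLpNorm g 2 (volume.restrict (Icc (0 : ℝ) 1)) := by
        gcongr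
        exact eLpNorm_interpDeriv_le hN hg.1 (delayedNode_monotone z N)
          (delayedNode_succ_sub_le z hN) (enorm_delayedIncr_le hg)
    _ = _ := by ring

theorem tendsto_cmNorm_sub_delayedInterp (z : Prop) {w : PathSpace d} (hw : w ∈ cameronMartin d) :
    Tendsto (fun N : ℕ => cmNorm (w - delayedInterp z N w)) atTop (𝓝 0) := by
  obtain ⟨g, hg⟩ := hw
  refine tendsto_of_tendsto_of_tendsto_of_le_of_le' tendsto_const_nhds
    (tendsto_eLpNorm_interpDeriv_sub z hg.1) (.of_forall fun _ => zero_le) ?_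
  -- From `N ≥ ‖w‖` on, the clamp is inactive and the increments are exact integrals of `g`.
  obtain ⟨M, hM⟩ := exists_nat_ge ‖w‖
  filter_upwards [eventually_gt_atTop 0, eventually_ge_atTop M] with N hN hMN
  have hc : delayedIncr z N w =
      fun i => ∫ r in (delayedNode z N i : ℝ)..delayedNode z N (i + 1), g r := by
    funext i
    have hle : ∀ t, ‖w t‖ ≤ N := fun t =>
      (w.norm_coe_le_norm t).trans (hM.trans (by exact_mod_cast hMN))
    rw [← hg.sub_eq_integral, delayedIncr, clamp_of_norm_le (hle _), clamp_of_norm_le (hle _)]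
  rw [← hc, eLpNorm_sub_comm]
  exact (hg.sub (isL2Deriv_interp hN (delayedIncr z N w))).cmNorm_le

/-! ### Density of the variation processes -/

/-- The approximation of the process `u` by `delayedInterp`. -/
def delayedApprox {ν : Measure (PathSpace d)} (z : Prop) (N : ℕ)
    (u : PathSpace d →ₘ[ν] PathSpace d) : PathSpace d →ₘ[ν] PathSpace d :=
  AEEqFun.comp (delayedInterp z N) (continuous_delayedInterp z N) u

theorem coeFn_delayedApprox {ν : Measure (PathSpace d)} (z : Prop) (N : ℕ)
    (u : PathSpace d →ₘ[ν] PathSpace d) :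
    ∀ᵐ ω ∂ν, delayedApprox z N u ω = delayedInterp z N (u ω) :=
  AEEqFun.coeFn_comp _ _ u

/-- For `t` in `(j / N, (j + 1) / N]` only the ramps `i ≤ j` have started. They use nodes up to
index `j + 1`, that is, times up to `(j - 1) / N`, which precede `t` by more than `1 / N`. A node
moved to `1` carries the value `0` and no information. -/
theorem isDelayed_delayedApprox {ν : Measure (PathSpace d)} {z : Prop} {N : ℕ} (hN : 2 ≤ N)
    {u : PathSpace d →ₘ[ν] PathSpace d} (hu : IsAdapted ν u)
    (hz : z → ∀ᵐ ω ∂ν, u ω 1 = 0) : IsDelayed ν (1 / N) (delayedApprox z N u) := by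
  have hN0 : 0 < N := by omega
  have hN' : (0 : ℝ) < N := by exact_mod_cast hN0
  have happ := coeFn_delayedApprox z N u
  intro t
  rcases eq_or_lt_of_le t.2.1 with ht0 | ht0
  · left
    have ht : t = 0 := Subtype.ext ht0.symm
    filter_upwards [happ] with ω hω
    rw [hω, ht, delayedInterp_zero]
  obtain ⟨j, hj, hjt⟩ := exists_mem_Ioc_div hN0 ht0 t.2.2
  have hjt1 := (div_lt_iff₀ hN').1 hjt.1
  have hjt2 := (le_div_iff₀ hN').1 hjt.2
  have hramp : ∀ i, j < i → ramp N i t = 0 := fun i hi => ramp_eq_zero (by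
    have : (j : ℝ) + 1 ≤ i := by exact_mod_cast hi
    linarith)
  rcases Nat.eq_zero_or_pos j with rfl | hj0
  · left
    filter_upwards [happ] with ω hω
    rw [hω, delayedInterp, interp_apply]
    refine Finset.sum_eq_zero fun i _ => ?_
    rcases Nat.eq_zero_or_pos i with rfl | hi
    -- The first increment vanishes because the nodes `0` and `1` both sit at time `0`; `2 ≤ N`
    -- keeps node `1` from being moved to time `1`.
    · have h1 : delayedNode z N (0 + 1) = delayedNode z N 0 := by
        apply Subtype.ext
        rw [delayedNode_of_not (by omega) (by omega), delayedNode_of_not (by omega) (by omega)]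
      rw [delayedIncr, h1, sub_self, smul_zero]
    · rw [hramp i hi, zero_smul]
  right
  let s : I := ⟨((j - 1 : ℕ) : ℝ) / N, by positivity, div_le_one_of_le₀
    (by exact_mod_cast (by omega : j - 1 ≤ N)) hN'.le⟩
  refine ⟨s, ?_, ?_⟩
  · change ((j - 1 : ℕ) : ℝ) / N + 1 / N ≤ t
    rw [← add_div]
    push_cast [show 1 ≤ j from hj0]
    rw [sub_add_cancel]
    exact hjt.1.le
  have hnode : ∀ i ≤ j + 1,
      Measurable[augFiltration ν s] fun ω => clamp N (u ω (delayedNode z N i)) := by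
    intro i hi
    refine (continuous_clamp N).measurable.comp ?_
    by_cases hzi : z ∧ N ≤ i
    · rw [delayedNode_one hzi]
      exact measurable_of_eventuallyEq (f := fun _ => 0) measurable_const (hz hzi.1)
    · refine (hu _).mono (augFiltration_mono ν ?_) le_rfl
      rw [← Subtype.coe_le_coe, delayedNode_of_not hzi (by omega)]
      exact div_le_div_of_nonneg_right (by exact_mod_cast (by omega : i - 2 ≤ j - 1)) hN'.le
  have hsum : Measurable[augFiltration ν s] fun ω => delayedInterp z N (u ω) t := by
    simp only [delayedInterp, interp_apply]
    refine Finset.measurable_fun_sum (m := augFiltration ν s) _ fun i _ => ?_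
    rcases le_or_gt i j with hij | hij
    · have hincr : Measurable[augFiltration ν s] fun ω => delayedIncr z N (u ω) i :=
        Measurable.sub (m := augFiltration ν s) (hnode (i + 1) (by omega)) (hnode i (by omega))
      exact (measurable_const_smul (ramp N i t)).comp hincr
    · simp only [hramp i hij, zero_smul]
      exact measurable_const
  exact measurable_of_eventuallyEq hsum (happ.mono fun ω hω => by simp only [hω])

theorem l2Norm_lt_top_of_cmNorm_lt {ν : Measure (PathSpace d)} [IsProbabilityMeasure ν]
    {u : PathSpace d →ₘ[ν] PathSpace d} {K : ℝ} (h : ∀ᵐ ω ∂ν, cmNorm (u ω) < ENNReal.ofReal K) :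
    l2Norm ν u < ∞ := by
  refine ENNReal.rpow_lt_top_of_nonneg (by norm_num) (ne_of_lt ?_)
  calc _ ≤ ∫⁻ _, ENNReal.ofReal K ^ 2 ∂ν :=
        lintegral_mono_ae (h.mono fun ω hω => pow_le_pow_left₀ zero_le hω.le 2)
    _ < ∞ := by simp

theorem cmNorm_delayedApprox_lt {ν : Measure (PathSpace d)} (z : Prop) {N : ℕ} (hN : 0 < N)
    (u : PathSpace d →ₘ[ν] PathSpace d) :
    ∃ K : ℝ, 0 < K ∧ ∀ᵐ ω ∂ν, cmNorm (delayedApprox z N u ω) < ENNReal.ofReal K := by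
  obtain ⟨K, hK, h⟩ := exists_cmNorm_delayedInterp_lt d z hN
  exact ⟨K, hK, (coeFn_delayedApprox z N u).mono fun ω hω => hω ▸ h _⟩

theorem delayedApprox_mem {ν : Measure (PathSpace d)} [IsProbabilityMeasure ν] {z : Prop} {N : ℕ}
    (hN : 2 ≤ N) {u : PathSpace d →ₘ[ν] PathSpace d} (hu : IsAdapted ν u)
    (hz : z → ∀ᵐ ω ∂ν, u ω 1 = 0) :
    delayedApprox z N u ∈ variationBdd ν ∩ lInftyH ν := by
  have hN0 : 0 < N := by omega
  have hdel := isDelayed_delayedApprox hN hu hz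
  have hδ : (0 : ℝ) < 1 / N := by positivity
  have happ := coeFn_delayedApprox z N u
  have hmem : ∀ᵐ ω ∂ν, delayedApprox z N u ω ∈ cameronMartin d :=
    happ.mono fun ω hω => hω ▸ delayedInterp_mem_cameronMartin hN0 _
  obtain ⟨K, hK, hlt⟩ := cmNorm_delayedApprox_lt z hN0 u
  exact ⟨⟨⟨⟨hmem, l2Norm_lt_top_of_cmNorm_lt hlt, hdel.isAdapted hδ⟩,
    fun U hU => hdel.add_mem_isoInitial hδ hU⟩,
    _, by positivity, happ.mono fun ω hω => hω ▸ norm_delayedInterp_lt z N (u ω)⟩, hmem, K, hK, hlt⟩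

theorem delayedApprox_mem_l2Adapted_zero {ν : Measure (PathSpace d)} [IsProbabilityMeasure ν]
    {N : ℕ} (hN : 2 ≤ N) {u : PathSpace d →ₘ[ν] PathSpace d}
    (hu : u ∈ l2Adapted ν (cameronMartinZero d)) :
    delayedApprox True N u ∈ l2Adapted ν (cameronMartinZero d) := by
  have h := (delayedApprox_mem (z := True) hN hu.2.2
    fun _ => hu.1.mono fun ω hω => hω.2).1.1.1
  refine ⟨?_, h.2⟩
  filter_upwards [coeFn_delayedApprox True N u, hu.1] with ω h1 h2
  rw [h1]
  exact delayedInterp_mem_cameronMartinZero (by omega) (apply_zero_of_mem_cameronMartin h2.1) h2.2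

theorem tendsto_l2Norm_sub_delayedApprox {ν : Measure (PathSpace d)} (z : Prop)
    {u : PathSpace d →ₘ[ν] PathSpace d} (hu : u ∈ l2Adapted ν (cameronMartin d)) :
    Tendsto (fun N : ℕ => l2Norm ν (u - delayedApprox z N u)) atTop (𝓝 0) := by
  obtain ⟨hmem, hfin, -⟩ := hu
  have hfin' : ∫⁻ ω, cmNorm (u ω) ^ 2 ∂ν ≠ ∞ := fun h => by
    rw [l2Norm, h] at hfin
    simp at hfin
  have hsub : ∀ N, ∀ᵐ ω ∂ν, (u - delayedApprox z N u) ω = u ω - delayedInterp z N (u ω) := by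
    intro N
    filter_upwards [AEEqFun.coeFn_sub u (delayedApprox z N u), coeFn_delayedApprox z N u]
      with ω h1 h2
    rw [h1, Pi.sub_apply, h2]
  have h1 : Tendsto (fun N : ℕ => ∫⁻ ω, cmNorm ((u - delayedApprox z N u) ω) ^ 2 ∂ν) atTop
      (𝓝 (∫⁻ _, 0 ∂ν)) := by
    -- Pathwise convergence holds on `H`, and `(3 * cmNorm (u ω)) ^ 2` is integrable since `u` has
    -- finite `L²` norm.
    refine tendsto_lintegral_filter_of_dominated_convergence
      (fun ω => (3 * cmNorm (u ω)) ^ 2) ?_ ?_ ?_ ?_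
    · exact .of_forall fun N => (measurable_cmNorm.comp (AEEqFun.measurable _)).pow_const 2
    · filter_upwards [eventually_gt_atTop 0] with N hN
      filter_upwards [hsub N] with ω h2
      rw [h2]
      exact pow_le_pow_left₀ zero_le (cmNorm_sub_delayedInterp_le z hN (u ω)) 2
    · simp only [mul_pow]
      rw [lintegral_const_mul' _ _ (by finiteness)]
      finiteness
    · filter_upwards [ae_all_iff.2 hsub, hmem] with ω h2 h3
      simp only [h2]
      simpa using ENNReal.Tendsto.pow (tendsto_cmNorm_sub_delayedInterp z h3) (n := 2)
  have h2 := h1.ennrpow_const (1 / 2 : ℝ)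
  simp only [lintegral_zero] at h2
  rwa [ENNReal.zero_rpow_of_pos (by norm_num)] at h2

/-- A set that contains all sufficiently fine delayed approximations is dense. -/
theorem isL2Dense_of_delayedApprox_mem {ν : Measure (PathSpace d)} (z : Prop)
    {A S : Set (PathSpace d →ₘ[ν] PathSpace d)} (hAS : A ⊆ S)
    (hS : S ⊆ l2Adapted ν (cameronMartin d))
    (h : ∀ u ∈ S, ∀ N : ℕ, 2 ≤ N → delayedApprox z N u ∈ A) : IsL2Dense ν A S := by
  refine ⟨hAS, fun u hu ε hε => ?_⟩
  obtain ⟨N, hN, hN2⟩ := (((tendsto_l2Norm_sub_delayedApprox z (hS hu)).eventually_lt_const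
    (ENNReal.ofReal_pos.2 hε)).and (eventually_ge_atTop 2)).exists
  exact ⟨_, h u hu N hN2, hN⟩

end VariationProcess

end

theorem proposition2p4 (d : ℕ) (ν : Measure (VariationProcess.PathSpace d))
    [IsProbabilityMeasure ν] :
    VariationProcess.IsL2Dense ν
        (VariationProcess.variationBdd ν ∩ VariationProcess.lInftyH ν)
        (VariationProcess.l2Adapted ν (VariationProcess.cameronMartin d)) ∧
      VariationProcess.IsL2Dense ν (VariationProcess.variationBdd ν)
        (VariationProcess.l2Adapted ν (VariationProcess.cameronMartin d)) ∧
      VariationProcess.IsL2Dense ν (VariationProcess.variation ν)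
        (VariationProcess.l2Adapted ν (VariationProcess.cameronMartin d)) ∧
      VariationProcess.IsL2Dense ν (VariationProcess.variationZeroBdd ν)
        (VariationProcess.l2Adapted ν (VariationProcess.cameronMartinZero d)) := by
  open VariationProcess in
  -- The unmodified grid is used here: moving a node to `1` would look into the future when `u` need
  -- not vanish at time `1`.
  have hmem : ∀ u ∈ l2Adapted ν (cameronMartin d), ∀ N : ℕ, 2 ≤ N →
      delayedApprox False N u ∈ variationBdd ν ∩ lInftyH ν :=
    fun u hu N hN => delayedApprox_mem hN hu.2.2 False.elim
  refine ⟨isL2Dense_of_delayedApprox_mem False (fun u hu => hu.1.1.1) subset_rfl hmem,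
    isL2Dense_of_delayedApprox_mem False (fun u hu => hu.1.1) subset_rfl
      fun u hu N hN => (hmem u hu N hN).1,
    isL2Dense_of_delayedApprox_mem False (fun u hu => hu.1) subset_rfl
      fun u hu N hN => (hmem u hu N hN).1.1,
    isL2Dense_of_delayedApprox_mem True (fun u hu => hu.2.2)
      (fun u hu => ⟨hu.1.mono fun ω hω => hω.1, hu.2⟩) fun u hu N hN => ?_⟩
  have h := (delayedApprox_mem (z := True) hN hu.2.2 fun _ => hu.1.mono fun ω hω => hω.2).1
  exact ⟨h, h.1, delayedApprox_mem_l2Adapted_zero hN hu⟩
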